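/- **Theorem (Probabilistic exhaustivity).** *Setting.* Let $\mathcal M\subseteq\mathbb R^N$ be open, let $g_1,\dots,g_m$ be smooth vector fields on $\mathcal M$, and let $U\subset\mathbb R^m$ be closed, bounded, symmetric about the origin, with $0$ in the interior of its convex hull. A *trajectory* is a continuous $x:[0,T]\to\mathcal M$, $T\ge 0$, with $x(t)=x(0)+\int_0^t\sum_i u_i(s)g_i(x(s))\,ds$ for some measurable $U$-valued control $u$; its cost is its Euclidean arc length $c(x)=\int_0^T\|\dot x(t)\|\,dt$, and $d(p,q)\in[0,\infty]$ is the infimum of the costs of the trajectories from $p$ to $q$. Let $L^k(p)$ be the span of the values at $p$ of the iterated Lie brackets of $g_1,\dots,g_m$ with at most $k$ terms, $n_k(p)=\dim L^k(p)$, $s(p)=\min\{k: L^k(p)=\mathbb R^N\}$, $w_i(p)=\min\{k: n_k(p)\ge i\}$ for $1\le i\le N$, and $D(p)=\sum_i w_i(p)$. *Privileged coordinates* at $p$ are functions $z_i=y_i+\mathrm{poly}_i(y_1,\dots,y_{i-1})$, where $y$ are the linear coordinates centred at $p$ with respect to an orthonormal basis $Y_1,\dots,Y_N$ of $\mathbb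 R^N$ such that $\{Y_i: w_i(p)\le k\}$ spans $L^k(p)$ for every $k$, $\mathrm{poly}_i$ has only terms of degree at least $2$ and less than $w_i(p)$, and $z_i$ has nonholonomic order $w_i(p)$ at $p$ (all derivatives $g_{j_1}\cdots g_{j_l}z_i(p)$ with $l<w_i(p)$ vanish, and some one with $l=w_i(p)$ does not). Put $\|z\|_p=\max_i|z_i|^{1/w_i(p)}$. *Assumptions $A_\Sigma$*, with constants $0<a_{\min}\le A_{\max}$, $\sigma_{\min}>0$, $\theta_{\min}>0$: (a) for every $p\in\mathcal M$ some $L^k(p)$ is $\mathbb R^N$; (b) the numbers $n_k$, $k\ge1$, are constant near every point of $\mathcal M$; (c) at every $p\in\mathcal M$ there are privileged coordinates $z$ with $a_{\min}\|z(q)\|_p\le d(p,q)\le A_{\max}\|z(q)\|_p$ for all $q\in\mathcal M$ with $d(p,q)<\sigma_{\min}$; (d) $\|p-q\|\le d(p,q)\le 2A_{\max}\|p-q\|^{1/s(p)}$ for all $p,q\in\mathcal M$ with $\|p-q\|\le\theta_{\min}$. Let $\mathcal M_{\rm obs}\subseteq\mathcal M$ with $\mathcal M\setminus\mathcal M_{\rm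 obs}$ open, let $\mathcal M_{\rm free}$ be the closure of $\mathcal M\setminus\mathcal M_{\rm obs}$ in $\mathcal M$, with Lebesgue measure $\mu(\mathcal M_{\rm free})<\infty$, and let $x_{\rm init}\in\mathcal M_{\rm free}$. Let $x:[0,T]\to\mathcal M_{\rm free}$ be a trajectory with strong $\delta$-clearance, $\delta>0$: $\|x(t)-q\|\ge\delta$ for all $t\in[0,T]$ and $q\in\mathcal M_{\rm obs}$. Let $D=D(x(0))$. *Tracing.* Points $y_1,\dots,y_M$, $M\ge1$, *$(\varepsilon,r)$-trace* $x$ if (i) $d(y_j,y_{j+1})\le r$ for all $j<M$; (ii) there is $\kappa>0$ such that every trajectory $y^*$ that runs through $y_1,\dots,y_M$ in this order, from $y_1$ to $y_M$, with each piece from $y_j$ to $y_{j+1}$ of length at most $d(y_j,y_{j+1})+\kappa$ (in particular every concatenation of optimal connections) satisfies $c(y^*)\le(1+\varepsilon)c(x)$ and lies within $r$ of $x$, that is, every point of $y^*$ has $d$-distance at most $r$ from some $x(t)$; moreover such $y^*$ exist for every $\kappa>0$; (iii) $[0,T]$ is a union of consecutive intervals $I_1,\dots,I_M$ with $d(y_j,x(t))\le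 r$ for all $t\in I_j$. *Claim.* Let $\varepsilon>0$, $\eta\ge0$, and $$r_n=4A_{\max}(1+\eta)^{1/D}\left(\frac{\mu(\mathcal M_{\rm free})}{D}\right)^{1/D}\left(\frac{\log n}{n}\right)^{1/D}.$$ Let $V$ consist of $x_{\rm init}$ and $n$ independent uniform samples from $\mathcal M_{\rm free}$, and let $A_n$ be the event that some $y_1,\dots,y_M\in V$ $(\varepsilon,r_n)$-trace $x$, with $y_1=x_{\rm init}$ in case $x(0)=x_{\rm init}$. Then, as $n\to\infty$, $$\mathbb P(A_n^c)=O\!\left(n^{-\eta/D}(\log n)^{-1/D}\right).$$ -/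

import Mathlib

open MeasureTheory Set Filter Topology
open scoped ENNReal NNReal

noncomputable section

namespace DCA

/-- The ambient Euclidean space `ℝ^N`. -/
abbrev E (N : ℕ) : Type := EuclideanSpace ℝ (Fin N)

/-- A driftless control-affine system `ẋ = ∑ i, u i • g i x`, `x ∈ M`, `u ∈ U`, on a configuration
manifold `M ⊆ ℝ^N` of full dimension `N` (that is, `M` is open). -/
structure System (N m : ℕ) where
  /-- configuration manifold -/
  M : Set (E N)
  isOpen_M : IsOpen M
  /-- control vector fields -/
  g : Fin m → E N → E N
  smooth_g : ∀ i, ContDiffOn ℝ ((⊤ : ℕ∞) : WithTop ℕ∞) (g i) M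
  /-- control set -/
  U : Set (E m)
  isClosed_U : IsClosed U
  isBounded_U : Bornology.IsBounded U
  symm_U : ∀ u ∈ U, -u ∈ U
  zero_mem_U : (0 : E m) ∈ interior (convexHull ℝ U)

namespace System

variable {N m : ℕ} (S : System N m)

/-! ### Trajectories, arc length, sub-Riemannian distance -/

/-- `x : [0,T] → M` is dynamically feasible: it is continuous and solves the system for some
measurable `U`-valued control, in the Carathéodory (integral) sense. Only the values of `x` on
`[0,T]` matter. -/
def IsTrajectory (x : ℝ → E N) (T : ℝ) : Prop :=
  0 ≤ T ∧ ContinuousOn x (Icc 0 T) ∧ (∀ t ∈ Icc 0 T, x t ∈ S.M) ∧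
    ∃ u : ℝ → E m, Measurable u ∧ (∀ t ∈ Icc 0 T, u t ∈ S.U) ∧
      ∀ t ∈ Icc 0 T, x t = x 0 + ∫ s in (0 : ℝ)..t, ∑ i, u s i • S.g i (x s)

/-- Euclidean arc length `∫ ‖ẋ(t)‖ dt` of the piece of `x` over `[a,b]`. -/
def arcLength {N : ℕ} (x : ℝ → E N) (a b : ℝ) : ℝ≥0∞ :=
  ∫⁻ t in Icc a b, ‖deriv x t‖ₑ

/-- Sub-Riemannian distance: infimum of the arc lengths of the trajectories from `p` to `q`
(`∞` if there are none). -/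
def dist (p q : E N) : ℝ≥0∞ :=
  ⨅ (x : ℝ → E N) (T : ℝ) (_ : S.IsTrajectory x T ∧ x 0 = p ∧ x T = q), arcLength x 0 T

/-! ### Iterated brackets, growth vector, weights -/

/-- `IsBracket k Z`: `Z` is an iterated Lie bracket `[g_{i₁},[g_{i₂},…]]` with `k` terms. -/
inductive IsBracket : ℕ → (E N → E N) → Prop
  | base (i : Fin m) : IsBracket 1 (S.g i)
  | step (i : Fin m) (k : ℕ) (Z : E N → E N) (hZ : IsBracket k Z) :
      IsBracket (k + 1) (VectorField.lieBracket ℝ (S.g i) Z)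

/-- `L^k(p)`: the span at `p` of the iterated brackets with at most `k` terms. -/
def L (k : ℕ) (p : E N) : Submodule ℝ (E N) :=
  Submodule.span ℝ {v | ∃ j ≤ k, ∃ Z, S.IsBracket j Z ∧ Z p = v}

/-- `n_k(p) = dim L^k(p)`. -/
def growth (k : ℕ) (p : E N) : ℕ := Module.finrank ℝ (S.L k p)

/-- Chow's condition. -/
def BracketGenerating : Prop := ∀ p ∈ S.M, ∃ k, S.L k p = ⊤

/-- `p` is a regular point: the growth vector is constant near `p`. -/
def IsRegularPoint (p : E N) : Prop := ∀ᶠ q in 𝓝 p, ∀ k, S.growth k q = S.growth k p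

/-- The degree of nonholonomy `s(p)`, the least `k` with `L^k(p) = T_p M`. -/
def step (p : E N) : ℕ := sInf {k | S.L k p = ⊤}

/-- The weights `w_1 ≤ … ≤ w_N` at `p`: `w_i = k` iff `n_{k-1}(p) < i ≤ n_k(p)`
(with `i` counted from `1`; here indices start at `0`). -/
def weight (p : E N) (i : Fin N) : ℕ := sInf {k | (i : ℕ) < S.growth k p}

/-- The homogeneous dimension `D = ∑ w_i`. -/
def homDim (p : E N) : ℕ := ∑ i, S.weight p i

/-! ### Privileged coordinates -/

/-- Iterated derivative `g_{i₁} g_{i₂} ⋯ g_{i_k} f` of a function along the control fields. -/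
def nonholDeriv (f : E N → ℝ) : List (Fin m) → E N → ℝ
  | [] => f
  | i :: l => fun p => fderiv ℝ (nonholDeriv f l) p (S.g i p)

/-- The nonholonomic order of `f` at `p` equals `w`. -/
def HasOrder (f : E N → ℝ) (p : E N) (w : ℕ) : Prop :=
  (∀ l : List (Fin m), l.length < w → S.nonholDeriv f l p = 0) ∧
    ∃ l : List (Fin m), l.length = w ∧ S.nonholDeriv f l p ≠ 0

/-- The coordinates `z_i = y_i + poly_i(y)` around `p`, where `y` are the linear coordinates centred
at `p` in the orthonormal basis `Y`. -/
def polyCoord {N : ℕ} (p : E N) (Y : OrthonormalBasis (Fin N) ℝ (E N))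
    (poly : Fin N → MvPolynomial (Fin N) ℝ) (q : E N) (i : Fin N) : ℝ :=
  Y.repr (q - p) i + MvPolynomial.eval (fun j => Y.repr (q - p) j) (poly i)

/-- `z` is a system of privileged coordinates at `p`: an orthonormal basis of `T_p M` adapted to the
flag `L^1(p) ⊆ L^2(p) ⊆ …` gives linear coordinates `y`; `z_i = y_i + poly_i(y_1, …, y_{i-1})` with
only terms of degree at least `2` and less than `w_i` in `poly_i`; and `z_i` has order `w_i`. -/
def IsPrivileged (p : E N) (z : E N → Fin N → ℝ) : Prop :=
  ∃ (Y : OrthonormalBasis (Fin N) ℝ (E N)) (poly : Fin N → MvPolynomial (Fin N) ℝ),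
    (∀ k, Submodule.span ℝ (Y '' {i | S.weight p i ≤ k}) = S.L k p) ∧
    (∀ i, ∀ j ∈ (poly i).vars, j < i) ∧
    (∀ i, ∀ α ∈ (poly i).support, 2 ≤ α.degree ∧ α.degree < S.weight p i) ∧
    z = polyCoord p Y poly ∧
    ∀ i, S.HasOrder (fun q => z q i) p (S.weight p i)

/-- The pseudonorm `max_i |z_i|^{1/w_i}` at `p`. -/
def pseudonorm (p : E N) (z : Fin N → ℝ) : ℝ := ⨆ i, |z i| ^ (1 / (S.weight p i : ℝ))

/-- The assumptions on the system, with the constants they provide: (a) bracket generation,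
(b) only regular points, (c) the ball-box estimate with uniform constants, (d) the
comparison with the Euclidean distance with a uniform radius. -/
structure Assumptions (aMin AMax σMin θMin : ℝ) : Prop where
  bracketGenerating : S.BracketGenerating
  regular : ∀ p ∈ S.M, S.IsRegularPoint p
  aMin_pos : 0 < aMin
  aMin_le : aMin ≤ AMax
  σMin_pos : 0 < σMin
  ballBox : ∀ p ∈ S.M, ∃ z : E N → Fin N → ℝ, S.IsPrivileged p z ∧
    ∀ q ∈ S.M, S.dist p q < ENNReal.ofReal σMin →
      ENNReal.ofReal (aMin * S.pseudonorm p (z q)) ≤ S.dist p q ∧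
      S.dist p q ≤ ENNReal.ofReal (AMax * S.pseudonorm p (z q))
  θMin_pos : 0 < θMin
  distComparison : ∀ p ∈ S.M, ∀ q ∈ S.M, ‖p - q‖ ≤ θMin →
    ENNReal.ofReal ‖p - q‖ ≤ S.dist p q ∧
    S.dist p q ≤ ENNReal.ofReal (2 * AMax * ‖p - q‖ ^ (1 / (S.step p : ℝ)))

/-! ### Obstacles and clearance -/

/-- The free space: the closure, in `M`, of `M \ M_obs`. -/
def free (Mobs : Set (E N)) : Set (E N) := closure (S.M \ Mobs) ∩ S.M

/-- A collision-free `x : [0,T] → M` has strong `δ`-clearance: each of its points is at Euclidean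
distance at least `δ` from every point of `M_obs`. -/
def StrongClearance (Mobs : Set (E N)) (δ : ℝ) (x : ℝ → E N) (T : ℝ) : Prop :=
  ∀ t ∈ Icc 0 T, x t ∈ S.free Mobs ∧ ∀ q ∈ Mobs, δ ≤ ‖x t - q‖

/-! ### Tracing -/

/-- `Y : [0,R] → M` is a trajectory through `y 0, …, y k` in this order, from `y 0` to `y k`, each
piece of which is optimal up to an error `κ` in length. For `κ = 0` this is the concatenation of
optimal connections. -/
def IsConnection (κ : ℝ≥0) {k : ℕ} (y : Fin (k + 1) → E N) (Y : ℝ → E N) (R : ℝ) : Prop :=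
  S.IsTrajectory Y R ∧ ∃ τ : Fin (k + 1) → ℝ, Monotone τ ∧ τ 0 = 0 ∧ τ (Fin.last k) = R ∧
    (∀ j, Y (τ j) = y j) ∧
    ∀ j : Fin k, arcLength Y (τ j.castSucc) (τ j.succ) ≤ S.dist (y j.castSucc) (y j.succ) + κ

/-- The waypoints `y 0, …, y k` `(ε, r)`-trace the trajectory `x` on `[0,T]`.

Optimal connections need not exist (`U` need not be convex), so the conditions on the concatenated
path are required of every connection that is optimal up to some fixed error `κ > 0`; this covers
all optimal connections, and connections with any given positive error do exist. The last field
says that the waypoints follow the whole of `x`, in order; without it one waypoint near `x` would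
always trace `x`. -/
structure Traces (x : ℝ → E N) (T ε r : ℝ) {k : ℕ} (y : Fin (k + 1) → E N) : Prop where
  gap : ∀ j : Fin k, S.dist (y j.castSucc) (y j.succ) ≤ ENNReal.ofReal r
  exists_connection : ∀ κ : ℝ≥0, 0 < κ → ∃ Y R, S.IsConnection κ y Y R
  cost_and_tube : ∃ κ : ℝ≥0, 0 < κ ∧ ∀ Y R, S.IsConnection κ y Y R →
    arcLength Y 0 R ≤ ENNReal.ofReal (1 + ε) * arcLength x 0 T ∧
    ∀ s ∈ Icc 0 R, ∃ t ∈ Icc 0 T, S.dist (Y s) (x t) ≤ ENNReal.ofReal r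
  follows : ∃ t : Fin (k + 2) → ℝ, Monotone t ∧ t 0 = 0 ∧ t (Fin.last (k + 1)) = T ∧
    ∀ j : Fin (k + 1), ∀ s ∈ Icc (t j.castSucc) (t j.succ),
      S.dist (y j) (x s) ≤ ENNReal.ofReal r

/-! ### Sampling -/

/-- The law of `n` independent uniform samples from the free space. -/
def sampleFree (Mobs : Set (E N)) (n : ℕ) : Measure (Fin n → E N) :=
  Measure.pi fun _ => ProbabilityTheory.cond volume (S.free Mobs)

/-- The connection radius, for volume `vol` of the free space and homogeneous dimension `D`. -/
def radius (AMax η vol : ℝ) (D n : ℕ) : ℝ :=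
  4 * AMax * (1 + η) ^ (1 / (D : ℝ)) * (vol / D) ^ (1 / (D : ℝ)) *
    (Real.log n / n) ^ (1 / (D : ℝ))

/-- The event that some sequence of points of `V = {x_init} ∪ {v_1, …, v_n}` `(ε, r)`-traces `x`;
if `x` starts at `x_init`, so does the sequence. -/
def traceEvent (xinit : E N) (x : ℝ → E N) (T ε r : ℝ) (n : ℕ) : Set (Fin n → E N) :=
  {v | ∃ (k : ℕ) (y : Fin (k + 1) → E N), (∀ j, y j ∈ insert xinit (range v)) ∧
    S.Traces x T ε r y ∧ (x 0 = xinit → y 0 = xinit)}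

end System

end DCA

end

/-! Mark points on `x` at equal arc length h, with r/3 ≤ h ≤ r/2, so that there are M + 1 of them
with M = ⌈2 c(x)/r⌉. Around each marked point take the box of weighted radius ρ = r/(4 `AMax`) in
privileged coordinates. These coordinates are a volume-preserving triangular change of variables, so
the box has volume exactly 2^N ρ^D, and by the ball-box estimate it lies in the d-ball of radius r/4
(`Assumptions.exists_box`). All n samples miss a given box with probability at most exp(-n 2^N
ρ^D/μ) ≤ n^(-(1+η)/D). There are O(1/ρ) = O((n/log n)^(1/D)) boxes, and the union bound gives
exactly the claimed rate.

One sample in every box makes consecutive waypoints at most r/4 + r/2 + r/4 = r apart and settles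
the gap, tube and order conditions, but the cost may still exceed c(x) by a constant factor. For the
cost, all but a small proportion of the marked points need a sample within βr/4, where β is of order
ε. Consider the concentric boxes of radius βρ. A pairwise disjoint family of k of them is missed
with probability at most exp(-const · k · log n). When k is a fixed fraction of M this outweighs the
2^(M+1) possible families, so the second event is negligible (`pi_miss_le`, `two_pow_mul_exp_le`).

Disjointness is the delicate point: `x` may turn back or cross itself, so points equally spaced in
length need not be separated. But length is a limit of chord sums. Cut `x` into P pieces, P
independent of n, whose chords nearly exhaust the length. Each piece is then nearly straight in the
metric sense, and a greedy choice keeps marked points at mutual Euclidean distance at least h/2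
while discarding few (`exists_separated`, `exists_separated_families`). Since d dominates the
Euclidean distance, the small boxes of one piece are disjoint. `traces_of_close` turns a bound on
the total error of the waypoints into tracing, and `measure_compl_traceEvent_le` assembles the
probability bound. -/

noncomputable section

namespace DCA

/-! ### Arc length -/

section ArcLength

variable {N : ℕ}

theorem arcLength_congr {x y : ℝ → E N} {a b : ℝ} (h : EqOn x y (Ioo a b)) :
    System.arcLength x a b = System.arcLength y a b := by
  unfold System.arcLength
  rw [← restrict_Ioo_eq_restrict_Icc]
  refine setLIntegral_congr_fun measurableSet_Ioo fun t ht => ?_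
  have : x =ᶠ[𝓝 t] y := by
    filter_upwards [Ioo_mem_nhds ht.1 ht.2] with s hs using h hs
  simp only [this.deriv_eq]

theorem arcLength_self (x : ℝ → E N) (a : ℝ) : System.arcLength x a a = 0 := by
  simp [System.arcLength]

theorem arcLength_le_add (x : ℝ → E N) {a b c : ℝ} (hab : a ≤ b) (hbc : b ≤ c) :
    System.arcLength x a c ≤ System.arcLength x a b + System.arcLength x b c := by
  unfold System.arcLength
  rw [← Icc_union_Icc_eq_Icc hab hbc]
  exact lintegral_union_le _ _ _

theorem arcLength_add_le (x : ℝ → E N) {a b c : ℝ} (hab : a ≤ b) (hbc : b ≤ c) :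
    System.arcLength x a b + System.arcLength x b c ≤ System.arcLength x a c := by
  unfold System.arcLength
  rw [← restrict_Ico_eq_restrict_Icc (a := a) (b := b), ← lintegral_union measurableSet_Icc]
  · exact lintegral_mono_set
      (union_subset (Ico_subset_Icc_self.trans (Icc_subset_Icc_right hbc)) (Icc_subset_Icc_left hab))
  · exact Set.disjoint_left.2 fun t h h' => absurd h.2 (not_lt.2 h'.1)

theorem arcLength_comp_const_add (x : ℝ → E N) (c a b : ℝ) :
    System.arcLength (fun t => x (c + t)) a b = System.arcLength x (c + a) (c + b) := by
  unfold System.arcLength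
  simp only [deriv_comp_const_add]
  have h := (measurePreserving_add_left (volume : Measure ℝ) c).setLIntegral_comp_preimage_emb
    (measurableEmbedding_addLeft c) (fun t => ‖deriv x t‖ₑ) (Icc (c + a) (c + b))
  rw [← h]
  simp

theorem arcLength_comp_const_sub (x : ℝ → E N) (c a b : ℝ) :
    System.arcLength (fun t => x (c - t)) a b = System.arcLength x (c - b) (c - a) := by
  unfold System.arcLength
  simp only [deriv_comp_const_sub, enorm_neg]
  have h := (Measure.measurePreserving_sub_left (volume : Measure ℝ) c).setLIntegral_comp_preimage_emb
    (MeasurableEquiv.subLeft c).measurableEmbedding (fun t => ‖deriv x t‖ₑ) (Icc (c - b) (c - a))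
  rw [← h]
  simp

theorem arcLength_le_sum (x : ℝ → E N) {k : ℕ} (τ : Fin (k + 1) → ℝ) (hτ : Monotone τ) :
    System.arcLength x (τ 0) (τ (Fin.last k)) ≤
      ∑ j : Fin k, System.arcLength x (τ j.castSucc) (τ j.succ) := by
  induction k with
  | zero => simp [arcLength_self]
  | succ k ih =>
    rw [Fin.sum_univ_castSucc]
    refine (arcLength_le_add x (b := τ (Fin.last k).castSucc) (hτ (Fin.zero_le _))
      (hτ (Fin.le_last _))).trans ?_
    exact add_le_add (ih (fun j => τ j.castSucc) fun i j h => hτ (by simpa using h)) le_rfl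

end ArcLength

/-! ### Velocity of a trajectory and its arc length. -/

namespace System

variable {N m : ℕ} (S : System N m)

/-- The velocity at time `s` of `x` under the control `u`. -/
def velocity (u : ℝ → E m) (x : ℝ → E N) (s : ℝ) : E N := ∑ i, u s i • S.g i (x s)

variable {S}

theorem integrableOn_velocity {u : ℝ → E m} {x : ℝ → E N} {T : ℝ}
    (hc : ContinuousOn x (Icc 0 T)) (hM : ∀ t ∈ Icc 0 T, x t ∈ S.M) (hu : Measurable u)
    (hU : ∀ t ∈ Icc 0 T, u t ∈ S.U) : IntegrableOn (S.velocity u x) (Icc 0 T) := by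
  obtain ⟨C, hC⟩ := S.isBounded_U.exists_norm_le
  have : S.velocity u x = ∑ i, fun s => u s i • S.g i (x s) := by
    ext s; simp [velocity]
  rw [this]
  refine integrable_finsetSum' _ fun i _ => ?_
  have h1 : ContinuousOn (fun s => S.g i (x s)) (Icc 0 T) :=
    (S.smooth_g i).continuousOn.comp hc hM
  refine (h1.integrableOn_compact isCompact_Icc).bdd_smul C (φ := fun s => u s i) ?_ ?_
  · exact (((EuclideanSpace.proj i : E m →L[ℝ] ℝ).continuous.measurable).comp
      hu).aestronglyMeasurable
  · refine ae_restrict_of_forall_mem measurableSet_Icc fun t ht => ?_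
    exact (PiLp.norm_apply_le (u t) i).trans (hC _ (hU t ht))

theorem IsTrajectory.exists_velocity {x : ℝ → E N} {T : ℝ} (hx : S.IsTrajectory x T) :
    ∃ f : ℝ → E N, IntegrableOn f (Icc 0 T) ∧
      ∀ t ∈ Icc 0 T, x t = x 0 + ∫ s in (0 : ℝ)..t, f s := by
  obtain ⟨_, hc, hM, u, hu, hU, h⟩ := hx
  exact ⟨S.velocity u x, integrableOn_velocity hc hM hu hU, h⟩

section Velocity

variable {f x : ℝ → E N} {T : ℝ}

theorem intervalIntegrable_of_Icc (hf : IntegrableOn f (Icc 0 T)) {a b : ℝ}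
    (ha : a ∈ Icc 0 T) (hb : b ∈ Icc 0 T) : IntervalIntegrable f volume a b :=
  (intervalIntegrable_iff.2 (hf.mono_set (uIoc_subset_uIcc.trans (uIcc_subset_Icc ha hb))))

theorem sub_eq_integral (hf : IntegrableOn f (Icc 0 T))
    (h : ∀ t ∈ Icc 0 T, x t = x 0 + ∫ s in (0 : ℝ)..t, f s) {a b : ℝ}
    (ha : a ∈ Icc 0 T) (hb : b ∈ Icc 0 T) : x b - x a = ∫ s in a..b, f s := by
  have h0 : (0 : ℝ) ∈ Icc 0 T := ⟨le_rfl, ha.1.trans ha.2⟩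
  rw [h b hb, h a ha, add_sub_add_left_eq_sub]
  exact intervalIntegral.integral_interval_sub_left (intervalIntegrable_of_Icc hf h0 hb)
    (intervalIntegrable_of_Icc hf h0 ha)

/-- By Lebesgue differentiation `x` has derivative `f` almost everywhere, so the length defined
through `deriv` is the L¹ norm of the velocity. -/
theorem arcLength_eq_lintegral (hf : IntegrableOn f (Icc 0 T))
    (h : ∀ t ∈ Icc 0 T, x t = x 0 + ∫ s in (0 : ℝ)..t, f s) {a b : ℝ}
    (ha : 0 ≤ a) (hb : b ≤ T) : arcLength x a b = ∫⁻ t in Icc a b, ‖f t‖ₑ := by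
  rcases lt_or_ge b a with hab | hab
  · simp [arcLength, Icc_eq_empty (not_le.2 hab)]
  have h0 : (0 : ℝ) ∈ Icc 0 T := ⟨le_rfl, ha.trans (hab.trans hb)⟩
  have hT : T ∈ Icc 0 T := ⟨ha.trans (hab.trans hb), le_rfl⟩
  unfold arcLength
  rw [← restrict_Ioo_eq_restrict_Icc]
  refine setLIntegral_congr_fun_ae measurableSet_Ioo ?_
  filter_upwards [(intervalIntegrable_of_Icc hf h0 hT).ae_hasDerivAt_integral] with t ht hts
  have hmem : t ∈ uIcc 0 T := by
    rw [uIcc_of_le hT.1]; exact ⟨ha.trans hts.1.le, hts.2.le.trans hb⟩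
  have hd := (ht hmem 0 (by rw [uIcc_of_le hT.1]; exact h0)).const_add (x 0)
  have heq : x =ᶠ[𝓝 t] fun t => x 0 + ∫ s in (0 : ℝ)..t, f s := by
    filter_upwards [Ioo_mem_nhds hts.1 hts.2] with s hs
    exact h s ⟨ha.trans hs.1.le, hs.2.le.trans hb⟩
  rw [heq.deriv_eq, hd.deriv]

theorem arcLength_eq_ofReal (hf : IntegrableOn f (Icc 0 T))
    (h : ∀ t ∈ Icc 0 T, x t = x 0 + ∫ s in (0 : ℝ)..t, f s) {a b : ℝ}
    (ha : 0 ≤ a) (hab : a ≤ b) (hb : b ≤ T) :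
    arcLength x a b = ENNReal.ofReal (∫ t in a..b, ‖f t‖) := by
  rw [arcLength_eq_lintegral hf h ha hb, intervalIntegral.integral_of_le hab,
    ← integral_Icc_eq_integral_Ioc,
    ofReal_integral_norm_eq_lintegral_enorm (hf.mono_set (Icc_subset_Icc ha hb))]

end Velocity

/-! ### Operations on trajectories -/

theorem IsTrajectory.restrict {x : ℝ → E N} {T : ℝ} (hx : S.IsTrajectory x T) {a b : ℝ}
    (ha : 0 ≤ a) (hab : a ≤ b) (hb : b ≤ T) :
    S.IsTrajectory (fun t => x (a + t)) (b - a) := by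
  obtain ⟨_, hc, hM, u, hu, hU, h⟩ := hx
  have hmem : ∀ t ∈ Icc 0 (b - a), a + t ∈ Icc 0 T := fun t ht =>
    ⟨add_nonneg ha ht.1, by linarith [ht.2]⟩
  refine ⟨sub_nonneg.2 hab, hc.comp (by fun_prop) hmem, fun t ht => hM _ (hmem t ht),
    fun t => u (a + t), hu.comp (measurable_const_add a), fun t ht => hU _ (hmem t ht),
    fun t ht => ?_⟩
  have hf := integrableOn_velocity hc hM hu hU
  have := sub_eq_integral hf h (a := a) (b := a + t) ⟨ha, hab.trans hb⟩ (hmem t ht)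
  rw [← sub_eq_iff_eq_add']
  simp only [add_zero]
  rw [this]
  have := intervalIntegral.integral_comp_add_left (S.velocity u x) a (a := 0) (b := t)
  rw [add_zero] at this
  exact this.symm

theorem IsTrajectory.reverse {x : ℝ → E N} {T : ℝ} (hx : S.IsTrajectory x T) :
    S.IsTrajectory (fun t => x (T - t)) T := by
  obtain ⟨hT, hc, hM, u, hu, hU, h⟩ := hx
  have hmem : ∀ t ∈ Icc 0 T, T - t ∈ Icc 0 T := fun t ht =>
    ⟨sub_nonneg.2 ht.2, by linarith [ht.1]⟩
  refine ⟨hT, hc.comp (by fun_prop) hmem, fun t ht => hM _ (hmem t ht),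
    fun t => - u (T - t), (hu.comp (measurable_const_sub T)).neg,
    fun t ht => S.symm_U _ (hU _ (hmem t ht)), fun t ht => ?_⟩
  have hf := integrableOn_velocity hc hM hu hU
  have := sub_eq_integral hf h (a := T - t) (b := T) (hmem t ht) ⟨hT, le_rfl⟩
  have h2 := intervalIntegral.integral_comp_sub_left (S.velocity u x) T (a := 0) (b := t)
  rw [sub_zero, ← this] at h2
  have h3 : ∫ s in (0 : ℝ)..t, ∑ i, (-u (T - s)) i • S.g i (x (T - s)) =
      - ∫ s in (0 : ℝ)..t, S.velocity u x (T - s) := by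
    rw [← intervalIntegral.integral_neg]
    congr 1; ext1 s
    simp [velocity]
  rw [h3, h2]
  simp

/-- Concatenation of two paths at time `T₁`. -/
def concat (x₁ : ℝ → E N) (T₁ : ℝ) (x₂ : ℝ → E N) (t : ℝ) : E N :=
  if t ≤ T₁ then x₁ t else x₂ (t - T₁)

theorem IsTrajectory.concat {x₁ x₂ : ℝ → E N} {T₁ T₂ : ℝ} (h₁ : S.IsTrajectory x₁ T₁)
    (h₂ : S.IsTrajectory x₂ T₂) (h : x₁ T₁ = x₂ 0) :
    S.IsTrajectory (System.concat x₁ T₁ x₂) (T₁ + T₂) := by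
  obtain ⟨hT₁, hc₁, hM₁, u₁, hu₁, hU₁, he₁⟩ := h₁
  obtain ⟨hT₂, hc₂, hM₂, u₂, hu₂, hU₂, he₂⟩ := h₂
  set Y := System.concat x₁ T₁ x₂ with hY
  have hY₁ : ∀ t ≤ T₁, Y t = x₁ t := fun t ht => if_pos ht
  have hY₂ : ∀ t, T₁ ≤ t → Y t = x₂ (t - T₁) := by
    intro t ht
    rcases ht.eq_or_lt with rfl | ht
    · rw [hY₁ _ le_rfl, h, sub_self]
    · exact if_neg (not_le.2 ht)
  have hmem₂ : ∀ t ∈ Icc T₁ (T₁ + T₂), t - T₁ ∈ Icc 0 T₂ := fun t ht =>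
    ⟨by linarith [ht.1], by linarith [ht.2]⟩
  have hcase : ∀ t ∈ Icc 0 (T₁ + T₂), (t ∈ Icc 0 T₁) ∨ (T₁ < t ∧ t ∈ Icc T₁ (T₁ + T₂)) := by
    intro t ht
    rcases le_or_gt t T₁ with h | h
    · exact .inl ⟨ht.1, h⟩
    · exact .inr ⟨h, h.le, ht.2⟩
  have hc : ContinuousOn Y (Icc 0 (T₁ + T₂)) := by
    rw [← Icc_union_Icc_eq_Icc hT₁ (le_add_of_nonneg_right hT₂)]
    refine ContinuousOn.union_of_isClosed ?_ ?_ isClosed_Icc isClosed_Icc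
    · exact hc₁.congr fun t ht => hY₁ t ht.2
    · exact (hc₂.comp (by fun_prop) hmem₂).congr fun t ht => hY₂ t ht.1
  have hM : ∀ t ∈ Icc 0 (T₁ + T₂), Y t ∈ S.M := by
    intro t ht
    rcases hcase t ht with h' | ⟨-, h'⟩
    · rw [hY₁ t h'.2]; exact hM₁ t h'
    · rw [hY₂ t h'.1]; exact hM₂ _ (hmem₂ t h')
  have hu : Measurable fun t => if t ≤ T₁ then u₁ t else u₂ (t - T₁) :=
    Measurable.ite measurableSet_Iic hu₁ (hu₂.comp (measurable_sub_const T₁))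
  have hU : ∀ t ∈ Icc 0 (T₁ + T₂), (if t ≤ T₁ then u₁ t else u₂ (t - T₁)) ∈ S.U := by
    intro t ht
    rcases hcase t ht with h' | ⟨h1, h'⟩
    · rw [if_pos h'.2]; exact hU₁ t h'
    · rw [if_neg (not_le.2 h1)]; exact hU₂ _ (hmem₂ t h')
  refine ⟨add_nonneg hT₁ hT₂, hc, hM, _, hu, hU, ?_⟩
  have hf := integrableOn_velocity hc hM hu hU
  set u := fun t => if t ≤ T₁ then u₁ t else u₂ (t - T₁) with hudef
  change ∀ t ∈ Icc 0 (T₁ + T₂), Y t = Y 0 + ∫ s in (0 : ℝ)..t, S.velocity u Y s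
  have key₁ : ∀ t ∈ Icc 0 T₁, ∫ s in (0 : ℝ)..t, S.velocity u Y s =
      ∫ s in (0 : ℝ)..t, S.velocity u₁ x₁ s := by
    intro t ht
    refine intervalIntegral.integral_congr fun s hs => ?_
    rw [uIcc_of_le ht.1] at hs
    simp only [velocity, hudef, if_pos (hs.2.trans ht.2), hY₁ s (hs.2.trans ht.2)]
  intro t ht
  rw [hY₁ 0 hT₁]
  rcases hcase t ht with h' | ⟨h1, h'⟩
  · rw [key₁ t h', hY₁ t h'.2]
    exact he₁ t h'
  · have hT₁m : T₁ ∈ Icc 0 (T₁ + T₂) := ⟨hT₁, h'.1.trans h'.2⟩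
    have h0m : (0 : ℝ) ∈ Icc 0 (T₁ + T₂) := ⟨le_rfl, hT₁.trans hT₁m.2⟩
    rw [← intervalIntegral.integral_add_adjacent_intervals (intervalIntegrable_of_Icc hf h0m hT₁m)
      (intervalIntegrable_of_Icc hf hT₁m ht), key₁ T₁ ⟨hT₁, le_rfl⟩, ← add_assoc]
    have e1 : x₁ 0 + ∫ s in (0 : ℝ)..T₁, S.velocity u₁ x₁ s = x₂ 0 := by
      rw [← h]; exact (he₁ T₁ ⟨hT₁, le_rfl⟩).symm
    have e2 : ∫ s in T₁..t, S.velocity u Y s = ∫ s in T₁..t, S.velocity u₂ x₂ (s - T₁) := by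
      rw [intervalIntegral.integral_of_le h1.le, intervalIntegral.integral_of_le h1.le]
      refine setIntegral_congr_fun measurableSet_Ioc fun s hs => ?_
      simp only [velocity, hudef, if_neg (not_le.2 hs.1), hY₂ s hs.1.le]
    rw [e1, e2, intervalIntegral.integral_comp_sub_right, sub_self, hY₂ t h'.1]
    exact he₂ _ (hmem₂ t h')

theorem arcLength_concat_left (x₁ x₂ : ℝ → E N) {T₁ a b : ℝ} (hb : b ≤ T₁) :
    arcLength (System.concat x₁ T₁ x₂) a b = arcLength x₁ a b :=
  arcLength_congr fun _ ht => if_pos (ht.2.le.trans hb)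

theorem arcLength_concat_right (x₁ x₂ : ℝ → E N) (T₁ b : ℝ) :
    arcLength (System.concat x₁ T₁ x₂) T₁ (T₁ + b) = arcLength x₂ 0 b := by
  have : arcLength (System.concat x₁ T₁ x₂) T₁ (T₁ + b) =
      arcLength (fun t => x₂ (-T₁ + t)) T₁ (T₁ + b) :=
    arcLength_congr fun t ht => by
      simp only [System.concat, if_neg (not_le.2 ht.1), neg_add_eq_sub]
  rw [this, arcLength_comp_const_add]
  simp

theorem isTrajectory_const {p : E N} (hp : p ∈ S.M) : S.IsTrajectory (fun _ => p) 0 := by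
  obtain ⟨v, hv⟩ : S.U.Nonempty := by
    rw [← convexHull_nonempty_iff (𝕜 := ℝ)]
    exact ⟨0, interior_subset S.zero_mem_U⟩
  refine ⟨le_rfl, continuousOn_const, fun _ _ => hp, fun _ => v, measurable_const,
    fun _ _ => hv, fun t ht => ?_⟩
  obtain rfl : t = 0 := le_antisymm ht.2 ht.1
  simp

/-! ### The sub-Riemannian distance -/

theorem IsTrajectory.dist_le {x : ℝ → E N} {T : ℝ} (hx : S.IsTrajectory x T) {p q : E N}
    (hp : x 0 = p) (hq : x T = q) : S.dist p q ≤ arcLength x 0 T :=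
  iInf_le_of_le x (iInf_le_of_le T (iInf_le_of_le ⟨hx, hp, hq⟩ le_rfl))

theorem IsTrajectory.dist_le_arcLength {x : ℝ → E N} {T : ℝ} (hx : S.IsTrajectory x T) {a b : ℝ}
    (ha : 0 ≤ a) (hab : a ≤ b) (hb : b ≤ T) : S.dist (x a) (x b) ≤ arcLength x a b := by
  refine ((hx.restrict ha hab hb).dist_le (p := x a) (q := x b) (by simp) (by simp)).trans ?_
  rw [arcLength_comp_const_add]
  simp

theorem exists_trajectory_of_dist_lt {p q : E N} {c : ℝ≥0∞} (h : S.dist p q < c) :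
    ∃ x T, S.IsTrajectory x T ∧ x 0 = p ∧ x T = q ∧ arcLength x 0 T < c := by
  simp only [dist, iInf_lt_iff] at h
  obtain ⟨x, T, ⟨h1, h2, h3⟩, h4⟩ := h
  exact ⟨x, T, h1, h2, h3, h4⟩

theorem dist_self {p : E N} (hp : p ∈ S.M) : S.dist p p = 0 :=
  le_antisymm (((isTrajectory_const hp).dist_le rfl rfl).trans (arcLength_self _ _).le) zero_le

theorem dist_comm_le (p q : E N) : S.dist q p ≤ S.dist p q := by
  refine le_of_forall_gt fun c hc => ?_
  obtain ⟨x, T, hx, rfl, rfl, h⟩ := exists_trajectory_of_dist_lt hc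
  refine (hx.reverse.dist_le (p := x T) (q := x 0) (by simp) (by simp)).trans_lt ?_
  rw [arcLength_comp_const_sub]
  simpa using h

theorem dist_comm (p q : E N) : S.dist p q = S.dist q p :=
  le_antisymm (dist_comm_le q p) (dist_comm_le p q)

theorem dist_triangle (p q s : E N) : S.dist p s ≤ S.dist p q + S.dist q s := by
  refine le_of_forall_gt fun c hc => ?_
  obtain ⟨c₁, h₁, c₂, h₂, hlt⟩ : ∃ c₁, S.dist p q < c₁ ∧ ∃ c₂, S.dist q s < c₂ ∧ c₁ + c₂ < c := by
    obtain ⟨c₁, h₁, h₁'⟩ := exists_between (lt_tsub_iff_right.2 hc)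
    obtain ⟨c₂, h₂, h₂'⟩ := exists_between (lt_tsub_iff_left.2 (lt_tsub_iff_right.1 h₁'))
    exact ⟨c₁, h₁, c₂, h₂, lt_tsub_iff_left.1 h₂'⟩
  obtain ⟨x, T, hx, rfl, rfl, h⟩ := exists_trajectory_of_dist_lt h₁
  obtain ⟨y, R, hy, hy0, rfl, h'⟩ := exists_trajectory_of_dist_lt h₂
  refine ((hx.concat hy hy0.symm).dist_le (p := x 0) (q := y R) ?_ ?_).trans_lt ?_
  · simp [System.concat, hx.1]
  · rcases hy.1.eq_or_lt with h | h
    · simp [System.concat, ← h, hy0]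
    · simp [System.concat, not_le.2 h]
  · refine (arcLength_le_add _ hx.1 (le_add_of_nonneg_right hy.1)).trans_lt ?_
    rw [arcLength_concat_left _ _ le_rfl, arcLength_concat_right]
    exact (ENNReal.add_lt_add h h').trans hlt

theorem IsTrajectory.norm_sub_le_arcLength {x : ℝ → E N} {T : ℝ} (hx : S.IsTrajectory x T)
    {a b : ℝ} (ha : 0 ≤ a) (hab : a ≤ b) (hb : b ≤ T) :
    ENNReal.ofReal ‖x b - x a‖ ≤ arcLength x a b := by
  obtain ⟨f, hf, h⟩ := hx.exists_velocity
  rw [arcLength_eq_ofReal hf h ha hab hb,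
    sub_eq_integral hf h ⟨ha, hab.trans hb⟩ ⟨ha.trans hab, hb⟩]
  exact ENNReal.ofReal_le_ofReal (intervalIntegral.norm_integral_le_integral_norm hab)

/-- A chord is no longer than its curve. Unlike the lower bound in the assumptions, this needs no
closeness of the two points. -/
theorem norm_sub_le_dist (p q : E N) : ENNReal.ofReal ‖p - q‖ ≤ S.dist p q := by
  refine le_of_forall_gt fun c hc => ?_
  obtain ⟨x, T, hx, rfl, rfl, h⟩ := exists_trajectory_of_dist_lt hc
  rw [norm_sub_rev]
  exact (hx.norm_sub_le_arcLength le_rfl hx.1 le_rfl).trans_lt h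

/-- A finite infimum is attained up to any `κ > 0`; near-optimal pieces are appended one at a time.
-/
theorem exists_isConnection {κ : ℝ≥0} (hκ : 0 < κ) {k : ℕ} (y : Fin (k + 1) → E N)
    (h0 : y 0 ∈ S.M) (hd : ∀ j : Fin k, S.dist (y j.castSucc) (y j.succ) ≠ ⊤) :
    ∃ Y R, S.IsConnection κ y Y R := by
  induction k with
  | zero =>
    refine ⟨fun _ => y 0, 0, isTrajectory_const h0, fun _ => 0, monotone_const, rfl, rfl, ?_, ?_⟩
    · intro j; rw [Fin.fin_one_eq_zero j]
    · exact fun j => j.elim0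
  | succ k ih =>
    obtain ⟨Y, R, hY, τ, hτ, hτ0, hτR, hτy, hτd⟩ := ih (fun j => y j.castSucc) h0
      fun j => hd j.castSucc
    obtain ⟨x, T, hx, hx0, hxT, hlt⟩ := exists_trajectory_of_dist_lt
      (ENNReal.lt_add_right (hd (Fin.last k)) (ENNReal.coe_ne_zero.2 hκ.ne'))
    have hYR : Y R = y (Fin.last k).castSucc := by rw [← hτR]; exact hτy _
    have hτle : ∀ j, τ j ≤ R := fun j => by rw [← hτR]; exact hτ (Fin.le_last j)
    refine ⟨concat Y R x, R + T, hY.concat hx (hYR.trans hx0.symm),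
      Fin.snoc (α := fun _ => ℝ) τ (R + T), ?_, ?_, ?_, ?_, ?_⟩
    · intro i j hij
      induction j using Fin.lastCases with
      | last =>
        rw [Fin.snoc_last]
        induction i using Fin.lastCases with
        | last => rw [Fin.snoc_last]
        | cast i => rw [Fin.snoc_castSucc]; linarith [hτle i, hx.1]
      | cast j =>
        induction i using Fin.lastCases with
        | last => exact absurd hij (not_le.2 (Fin.castSucc_lt_last j))
        | cast i => rw [Fin.snoc_castSucc, Fin.snoc_castSucc]; exact hτ (by simpa using hij)
    · have : (0 : Fin (k + 1 + 1)) = Fin.castSucc 0 := rfl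
      rw [this, Fin.snoc_castSucc, hτ0]
    · rw [Fin.snoc_last]
    · intro j
      induction j using Fin.lastCases with
      | last =>
        rw [Fin.snoc_last, ← Fin.succ_last, ← hxT]
        rcases hx.1.eq_or_lt with h | h
        · simp [System.concat, ← h, hYR, hx0]
        · simp [System.concat, not_le.2 h]
      | cast j =>
        rw [Fin.snoc_castSucc, System.concat, if_pos (hτle j), hτy]
    · intro j
      induction j using Fin.lastCases with
      | last =>
        rw [Fin.succ_last, Fin.snoc_last, Fin.snoc_castSucc, hτR, arcLength_concat_right]
        exact hlt.le
      | cast j =>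
        rw [Fin.succ_castSucc, Fin.snoc_castSucc, Fin.snoc_castSucc,
          arcLength_concat_left _ _ (hτle _)]
        exact hτd j

end System

/-! ### Triangular changes of coordinates -/

section Shear

variable {ι : Type*} [DecidableEq ι]

/-- The shear `y ↦ y + P y • e_i`. -/
def shear (i : ι) (P : (ι → ℝ) → ℝ) (y : ι → ℝ) : ι → ℝ :=
  Function.update y i (y i + P y)

theorem shear_shear_neg {i : ι} {P : (ι → ℝ) → ℝ} (h : ∀ y c, P (Function.update y i c) = P y)
    (y : ι → ℝ) : shear i P (shear i (fun y => -P y) y) = y := by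
  simp [shear, h]

/-- A shear along the `i`-th axis, by a function independent of the `i`-th coordinate. -/
def shearHomeomorph (i : ι) (P : (ι → ℝ) → ℝ) (hc : Continuous P)
    (h : ∀ y c, P (Function.update y i c) = P y) : (ι → ℝ) ≃ₜ (ι → ℝ) where
  toFun := shear i P
  invFun := shear i (fun y => -P y)
  left_inv y := by
    simpa using shear_shear_neg (i := i) (P := fun y => -P y) (by simpa using h) y
  right_inv := shear_shear_neg h
  continuous_toFun := continuous_id.update i ((continuous_apply i).add hc)
  continuous_invFun := continuous_id.update i ((continuous_apply i).add hc.neg)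

/-- Fubini: with the other coordinates fixed, `P` is constant and the shear is a translation of the
`i`-th coordinate. -/
theorem volume_preserving_shear [Fintype ι] (i : ι) (P : (ι → ℝ) → ℝ) (hc : Continuous P)
    (h : ∀ y c, P (Function.update y i c) = P y) : MeasurePreserving (shear i P) := by
  have ht : Measurable (shear i P) := (shearHomeomorph i P hc h).continuous.measurable
  refine ⟨ht, (Measure.pi_eq fun s hs => ?_).symm⟩
  have h2s : MeasurableSet (univ.pi s) := .pi countable_univ fun i _ => hs i
  simp_rw [← Measure.pi_pi, ← lintegral_indicator_one h2s]
  rw [lintegral_map (measurable_one.indicator h2s) ht, volume_pi]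
  refine lintegral_eq_of_lmarginal_eq {i} ((measurable_one.indicator h2s).comp ht)
    (measurable_one.indicator h2s) ?_
  simp_rw [lmarginal_singleton]
  ext x
  simp [shear, h,
    lintegral_add_right_eq_self fun xᵢ => indicator (univ.pi s) 1 (Function.update x i xᵢ)]

end Shear

/-- The map is a composition of shears applied from the highest coordinate down: each `P i` depends
only on coordinates below `i`, which are still unchanged when it is evaluated. -/
theorem exists_triangular_homeomorph {N : ℕ} (P : Fin N → (Fin N → ℝ) → ℝ)
    (hc : ∀ i, Continuous (P i))
    (h : ∀ i j, i ≤ j → ∀ y c, P i (Function.update y j c) = P i y) :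
    ∃ e : (Fin N → ℝ) ≃ₜ (Fin N → ℝ), (∀ y i, e y i = y i + P i y) ∧
      MeasurePreserving e := by
  suffices H : ∀ k ≤ N, ∃ e : (Fin N → ℝ) ≃ₜ (Fin N → ℝ),
      (∀ y i, e y i = if (i : ℕ) < k then y i + P i y else y i) ∧ MeasurePreserving e by
    obtain ⟨e, he, hm⟩ := H N le_rfl
    exact ⟨e, fun y i => by rw [he, if_pos i.2], hm⟩
  intro k hk
  induction k with
  | zero => exact ⟨Homeomorph.refl _, by simp, MeasurePreserving.id _⟩
  | succ k ih =>
    obtain ⟨e, he, hm⟩ := ih (Nat.le_of_succ_le hk)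
    set j : Fin N := ⟨k, hk⟩ with hj
    refine ⟨(shearHomeomorph j (P j) (hc j) (h j j le_rfl)).trans e, fun y i => ?_,
      hm.comp (volume_preserving_shear j (P j) (hc j) (h j j le_rfl))⟩
    change e (shear j (P j) y) i = _
    rw [he, shear]
    rcases lt_trichotomy (i : ℕ) k with hik | hik | hik
    · have hij : i ≠ j := fun h => by simp [h, hj] at hik
      rw [if_pos hik, if_pos (hik.trans k.lt_succ_self), Function.update_of_ne hij,
        h i j (by rw [Fin.le_def]; exact hik.le)]
    · obtain rfl : i = j := Fin.ext hik
      rw [if_neg hik.not_lt, if_pos (by omega), Function.update_self]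
    · have hij : i ≠ j := fun h => by simp [h, hj] at hik
      rw [if_neg hik.not_gt, if_neg (by omega), Function.update_of_ne hij]

/-! ### Privileged coordinates as volume-preserving homeomorphisms. -/

namespace System

variable {N m : ℕ} {S : System N m}

/-- Passing to the orthonormal basis is an isometry and the polynomial correction is triangular. The
correction has no constant term, so `p` is sent to the origin. -/
theorem IsPrivileged.exists_homeomorph {p : E N} {z : E N → Fin N → ℝ} (hz : S.IsPrivileged p z) :
    ∃ Φ : E N ≃ₜ (Fin N → ℝ), (∀ q, Φ q = z q) ∧ MeasurePreserving Φ ∧ z p = 0 := by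
  obtain ⟨Y, poly, -, hvars, hdeg, rfl, -⟩ := hz
  obtain ⟨e, he, hm⟩ := exists_triangular_homeomorph
    (fun i y => MvPolynomial.eval y (poly i)) (fun i => MvPolynomial.continuous_eval (poly i)) (by
      intro i j hij y c
      refine MvPolynomial.eval₂Hom_congr' rfl (fun l hl _ => ?_) rfl
      exact Function.update_of_ne ((hvars i l hl).trans_le hij).ne _ _)
  refine ⟨((Homeomorph.subRight p).trans Y.repr.toHomeomorph).trans
    ((PiLp.homeomorph 2 (fun _ : Fin N => ℝ)).trans e), fun q => ?_, ?_, ?_⟩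
  · ext i
    exact he _ i
  · exact hm.comp ((PiLp.volume_preserving_ofLp (Fin N)).comp
      (Y.measurePreserving_repr.comp (measurePreserving_sub_right volume p)))
  · ext i
    have : MvPolynomial.coeff 0 (poly i) = 0 := by
      by_contra hne
      have := (hdeg i 0 (MvPolynomial.mem_support_iff.2 hne)).1
      simp at this
    rw [← MvPolynomial.constantCoeff_eq] at this
    simpa [polyCoord, ← Pi.zero_def, MvPolynomial.eval_zero'] using this

/-! ### Weights -/

theorem growth_zero (p : E N) : S.growth 0 p = 0 := by
  have hb : ∀ k Z, S.IsBracket k Z → k ≠ 0 := by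
    intro k Z h; cases h <;> simp
  have : S.L 0 p = ⊥ := by
    rw [L, Submodule.span_eq_bot]
    rintro _ ⟨j, hj, Z, hZ, rfl⟩
    exact absurd (Nat.le_zero.1 hj) (hb j Z hZ)
  rw [growth, this, finrank_bot]

theorem weight_pos (hb : S.BracketGenerating) {p : E N} (hp : p ∈ S.M) (i : Fin N) :
    0 < S.weight p i := by
  obtain ⟨k, hk⟩ := hb p hp
  -- `sInf ∅ = 0` in `ℕ`, so a positive weight requires this set to be nonempty.
  have hne : {k | (i : ℕ) < S.growth k p}.Nonempty := by
    refine ⟨k, ?_⟩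
    rw [mem_ofPred_eq, growth, hk]
    simp
  rw [Nat.pos_iff_ne_zero]
  intro h0
  have := Nat.sInf_mem hne
  rw [show sInf {k | (i : ℕ) < S.growth k p} = 0 from h0] at this
  simp [growth_zero] at this

theorem step_pos (hb : S.BracketGenerating) (hN : 0 < N) {p : E N} (hp : p ∈ S.M) :
    0 < S.step p := by
  rw [Nat.pos_iff_ne_zero]
  intro h0
  have := Nat.sInf_mem (s := {k | S.L k p = ⊤}) (hb p hp)
  rw [show sInf {k | S.L k p = ⊤} = 0 from h0] at this
  have h1 := growth_zero (S := S) p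
  rw [growth, show S.L 0 p = ⊤ from this] at h1
  simp at h1
  omega

theorem homDim_pos (hb : S.BracketGenerating) (hN : 0 < N) {p : E N} (hp : p ∈ S.M) :
    0 < S.homDim p :=
  Finset.sum_pos (fun i _ => weight_pos hb hp i) ⟨⟨0, hN⟩, Finset.mem_univ _⟩

/-- The weights depend only on the growth vector, which is locally constant, and the time interval
is connected. Hence one exponent D serves for all boxes along `x`. -/
theorem homDim_eq_of_isTrajectory (hreg : ∀ p ∈ S.M, S.IsRegularPoint p) {x : ℝ → E N} {T : ℝ}
    (hx : S.IsTrajectory x T) {t : ℝ} (ht : t ∈ Icc 0 T) : S.homDim (x t) = S.homDim (x 0) := by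
  refine isPreconnected_Icc.constant (f := fun t => S.homDim (x t)) ?_ ht ⟨le_rfl, hx.1⟩
  intro s hs
  refine (tendsto_pure.2 ?_).mono_right (pure_le_nhds _)
  filter_upwards [hx.2.1 s hs (hreg _ (hx.2.2.1 s hs))] with s' hs'
  simp only [mem_preimage, mem_ofPred_eq] at hs'
  simp [homDim, weight, hs']

/-! ### Boxes -/

/-- The box of radius `ρ` around the origin with weights `w`. -/
def box (w : Fin N → ℕ) (ρ : ℝ) : Set (Fin N → ℝ) :=
  Icc (fun i => -ρ ^ w i) (fun i => ρ ^ w i)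

theorem volume_box (w : Fin N → ℕ) {ρ : ℝ} (hρ : 0 ≤ ρ) :
    volume (box w ρ) = ENNReal.ofReal (2 ^ N * ρ ^ ∑ i, w i) := by
  rw [box, Real.volume_Icc_pi, ← ENNReal.ofReal_prod_of_nonneg]
  · congr 1
    simp only [sub_neg_eq_add, ← two_mul, Finset.prod_mul_distrib, Finset.prod_pow_eq_pow_sum]
    simp
  · intro i _
    have := pow_nonneg hρ (w i)
    linarith

theorem pseudonorm_le_of_mem_box (hb : S.BracketGenerating) (hN : 0 < N) {p : E N}
    (hp : p ∈ S.M) {ρ : ℝ} (hρ : 0 ≤ ρ) {v : Fin N → ℝ} (hv : v ∈ box (S.weight p) ρ) :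
    S.pseudonorm p v ≤ ρ := by
  have : Nonempty (Fin N) := ⟨⟨0, hN⟩⟩
  refine ciSup_le fun i => ?_
  have h1 : |v i| ≤ ρ ^ S.weight p i := abs_le.2 ⟨hv.1 i, hv.2 i⟩
  calc |v i| ^ (1 / (S.weight p i : ℝ))
      ≤ (ρ ^ S.weight p i) ^ (1 / (S.weight p i : ℝ)) := by
        gcongr
    _ = ρ := by
        rw [one_div, Real.pow_rpow_inv_natCast hρ (weight_pos hb hp i).ne']

variable {aMin AMax σMin θMin : ℝ}

theorem Assumptions.AMax_pos (hS : S.Assumptions aMin AMax σMin θMin) : 0 < AMax :=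
  hS.aMin_pos.trans_le hS.aMin_le

/-- The upper bound by a positive power of the Euclidean distance makes d continuous for the
Euclidean topology; this is what the connectedness argument for boxes uses. -/
theorem Assumptions.eventually_dist_lt (hS : S.Assumptions aMin AMax σMin θMin) (hN : 0 < N)
    {q : E N} (hq : q ∈ S.M) {c : ℝ≥0∞} (hc : 0 < c) : ∀ᶠ q' in 𝓝 q, S.dist q q' < c := by
  have hlim : Tendsto (fun q' => ENNReal.ofReal (2 * AMax * ‖q - q'‖ ^ (1 / (S.step q : ℝ))))
      (𝓝 q) (𝓝 0) := by
    have hpos : 0 < 1 / (S.step q : ℝ) := by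
      have := step_pos hS.bracketGenerating hN hq
      positivity
    have hcont : Continuous fun q' : E N =>
        ENNReal.ofReal (2 * AMax * ‖q - q'‖ ^ (1 / (S.step q : ℝ))) := by
      refine ENNReal.continuous_ofReal.comp (continuous_const.mul ?_)
      exact (continuous_const.sub continuous_id).norm.rpow_const fun _ => .inr hpos.le
    have := hcont.tendsto q
    rwa [sub_self, norm_zero, Real.zero_rpow hpos.ne', mul_zero, ENNReal.ofReal_zero] at this
  have hball : ∀ᶠ q' in 𝓝 q, ‖q - q'‖ ≤ θMin := by
    filter_upwards [Metric.closedBall_mem_nhds q hS.θMin_pos] with q' hq'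
    rwa [Metric.mem_closedBall, dist_eq_norm, norm_sub_rev] at hq'
  filter_upwards [hlim.eventually_lt_const hc, hball, S.isOpen_M.mem_nhds hq] with q' h1 h2 h3
  exact ((hS.distComparison q hq q' h3 h2).2).trans_lt h1

/-- Around a point at distance more than `AMax * ρ` from the complement of `M`, the box of radius
`ρ` in suitable privileged coordinates is contained in the ball of radius `AMax * ρ`. -/
theorem Assumptions.exists_box (hS : S.Assumptions aMin AMax σMin θMin) (hN : 0 < N)
    {p : E N} (hp : p ∈ S.M) {ρ₀ : ℝ} (hσ : AMax * ρ₀ < σMin)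
    (hM : Metric.closedBall p (AMax * ρ₀) ⊆ S.M) :
    ∃ Q : ℝ → Set (E N), ∀ ρ, 0 ≤ ρ → ρ ≤ ρ₀ → MeasurableSet (Q ρ) ∧
      volume (Q ρ) = ENNReal.ofReal (2 ^ N * ρ ^ S.homDim p) ∧
      ∀ q ∈ Q ρ, S.dist p q ≤ ENNReal.ofReal (AMax * ρ) := by
  obtain ⟨z, hz, hbb⟩ := hS.ballBox p hp
  obtain ⟨Φ, hΦ, hm, hz0⟩ := hz.exists_homeomorph
  have hA := hS.AMax_pos
  refine ⟨fun ρ => Φ ⁻¹' box (S.weight p) ρ, fun ρ hρ hρ₀ => ⟨?_, ?_, ?_⟩⟩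
  · exact Φ.continuous.measurable measurableSet_Icc
  · exact (hm.measure_preimage measurableSet_Icc.nullMeasurableSet).trans (volume_box _ hρ)
  have hle : AMax * ρ ≤ AMax * ρ₀ := by gcongr
  have hest : ∀ q ∈ Φ ⁻¹' box (S.weight p) ρ, q ∈ S.M → S.dist p q < ENNReal.ofReal σMin →
      S.dist p q ≤ ENNReal.ofReal (AMax * ρ) := by
    intro q hq hqM hd
    refine (hbb q hqM hd).2.trans (ENNReal.ofReal_le_ofReal ?_)
    gcongr
    refine pseudonorm_le_of_mem_box hS.bracketGenerating hN hp hρ ?_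
    rw [← hΦ]; exact hq
  -- The ball-box estimate applies only where d(p, ·) is already below `σMin`. On the connected box,
  -- the open condition `W` and the closed condition `C` coincide and hold at `p`, hence hold
  -- throughout.
  have hpre : IsPreconnected (Φ ⁻¹' box (S.weight p) ρ) := by
    rw [← Φ.image_symm]
    exact (convex_Icc _ _).isPreconnected.image _ Φ.symm.continuous.continuousOn
  have hpQ : p ∈ Φ ⁻¹' box (S.weight p) ρ := by
    rw [mem_preimage, hΦ, hz0]
    exact ⟨fun i => by simpa using pow_nonneg hρ _, fun i => by simpa using pow_nonneg hρ _⟩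
  set W : Set (E N) := {q | q ∈ S.M ∧ S.dist p q < ENNReal.ofReal σMin} with hW
  -- The Euclidean bound confines `C` to a closed ball inside `M`, where d(p, ·) is continuous, so
  -- `C` is closed in the whole space and not only relative to `M`.
  set C : Set (E N) := {q | ‖q - p‖ ≤ AMax * ρ ∧ S.dist p q ≤ ENNReal.ofReal (AMax * ρ)} with hC
  have hWo : IsOpen W := by
    rw [isOpen_iff_eventually]
    rintro q ⟨hq, hd⟩
    filter_upwards [S.isOpen_M.mem_nhds hq,
      hS.eventually_dist_lt hN hq (tsub_pos_of_lt hd)] with q' h1 h2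
    exact ⟨h1, (dist_triangle p q q').trans_lt (lt_tsub_iff_left.1 h2)⟩
  have hCc : IsOpen Cᶜ := by
    rw [isOpen_iff_eventually]
    intro q hq
    by_cases hn : ‖q - p‖ ≤ AMax * ρ
    · have hqM : q ∈ S.M := hM (by
        rw [Metric.mem_closedBall, dist_eq_norm]; exact hn.trans hle)
      have hd : ENNReal.ofReal (AMax * ρ) < S.dist p q := by
        by_contra h
        exact hq ⟨hn, not_lt.1 h⟩
      filter_upwards [hS.eventually_dist_lt hN hqM (tsub_pos_of_lt hd)] with q' h1 h2
      refine absurd h2.2 (not_le.2 ?_)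
      by_contra hcon
      have h3 := dist_triangle (S := S) p q' q
      rw [dist_comm q' q] at h3
      have h4 := lt_tsub_iff_left.1 h1
      exact absurd (h3.trans (add_le_add_left (not_lt.1 hcon) _)) (not_le.2 h4)
    · have : IsOpen {q : E N | AMax * ρ < ‖q - p‖} :=
        isOpen_lt continuous_const (by fun_prop)
      filter_upwards [this.mem_nhds (not_le.1 hn)] with q' h1 h2
      exact absurd h2.1 (not_le.2 h1)
  have hCof : ∀ q ∈ Φ ⁻¹' box (S.weight p) ρ, q ∈ W → q ∈ C := by
    rintro q hq ⟨h1, h2⟩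
    have h3 := hest q hq h1 h2
    refine ⟨?_, h3⟩
    have := (norm_sub_le_dist (S := S) p q).trans h3
    rw [norm_sub_rev]
    exact (ENNReal.ofReal_le_ofReal_iff (by positivity)).1 this
  have hCW : C ⊆ W := by
    rintro q ⟨h1, h2⟩
    refine ⟨hM (by rw [Metric.mem_closedBall, dist_eq_norm]; exact h1.trans hle), h2.trans_lt ?_⟩
    exact (ENNReal.ofReal_lt_ofReal_iff hS.σMin_pos).2 (hle.trans_lt hσ)
  have hsub : Φ ⁻¹' box (S.weight p) ρ ⊆ W := by
    intro q hq
    by_contra hqW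
    obtain ⟨q', hq', hW', hC'⟩ := hpre W Cᶜ hWo hCc
      (fun q _ => (em (q ∈ C)).imp (fun h => hCW h) id)
      ⟨p, hpQ, hp, by rw [dist_self hp]; exact ENNReal.ofReal_pos.2 hS.σMin_pos⟩
      ⟨q, hq, fun h => hqW (hCW h)⟩
    exact hC' (hCof q' hq' hW')
  exact fun q hq => (hCof q hq (hsub hq)).2

end System

/-! ### Length as a limit of chord sums -/

/-- For a constant velocity, length and chord agree. Replacing `f` by the constant `φ a` costs the
L¹ error plus `ω * (b - a)`, once in the length and once in the chord. -/
theorem integral_norm_le_of_norm_sub_le {F : Type*} [NormedAddCommGroup F] [NormedSpace ℝ F]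
    [CompleteSpace F] {f φ : ℝ → F} {a b ω : ℝ} (hab : a ≤ b)
    (hf : IntervalIntegrable f volume a b) (hφ : Continuous φ)
    (hω : ∀ s ∈ Icc a b, ‖φ s - φ a‖ ≤ ω) :
    ∫ s in a..b, ‖f s‖ ≤
      ‖∫ s in a..b, f s‖ + (2 * ∫ s in a..b, ‖f s - φ s‖) + 2 * ω * (b - a) := by
  have hd : IntervalIntegrable (fun s => ‖f s - φ s‖) volume a b :=
    (hf.sub (hφ.intervalIntegrable a b)).norm
  have h1 : ∫ s in a..b, ‖f s‖ ≤ ∫ s in a..b, (‖f s - φ s‖ + (‖φ a‖ + ω)) := by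
    refine intervalIntegral.integral_mono_on hab hf.norm (hd.add intervalIntegrable_const) ?_
    intro s hs
    have e1 : ‖f s‖ ≤ ‖f s - φ s‖ + ‖φ s‖ := by simpa using norm_add_le (f s - φ s) (φ s)
    have e2 : ‖φ s‖ ≤ ‖φ s - φ a‖ + ‖φ a‖ := by simpa using norm_add_le (φ s - φ a) (φ a)
    linarith [hω s hs]
  have h2 : ∫ s in a..b, ‖f s - φ a‖ ≤ ∫ s in a..b, (‖f s - φ s‖ + ω) := by
    refine intervalIntegral.integral_mono_on hab (hf.sub intervalIntegrable_const).norm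
      (hd.add intervalIntegrable_const) ?_
    intro s hs
    have e1 : ‖f s - φ a‖ ≤ ‖f s - φ s‖ + ‖φ s - φ a‖ := by
      simpa using norm_add_le (f s - φ s) (φ s - φ a)
    linarith [hω s hs]
  have h3 : (b - a) * ‖φ a‖ ≤ ‖∫ s in a..b, f s‖ + ∫ s in a..b, ‖f s - φ a‖ := by
    have e1 : (b - a) • φ a = (∫ s in a..b, f s) - ∫ s in a..b, (f s - φ a) := by
      rw [intervalIntegral.integral_sub hf intervalIntegrable_const,
        intervalIntegral.integral_const]
      abel
    have e2 : (b - a) * ‖φ a‖ = ‖(b - a) • φ a‖ := by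
      rw [norm_smul, Real.norm_of_nonneg (sub_nonneg.2 hab)]
    rw [e2, e1]
    exact (norm_sub_le _ _).trans
      (add_le_add_right (intervalIntegral.norm_integral_le_integral_norm hab) _)
  rw [intervalIntegral.integral_add hd intervalIntegrable_const,
    intervalIntegral.integral_const, smul_eq_mul] at h1 h2
  linarith

theorem exists_integral_norm_le_sum {F : Type*} [NormedAddCommGroup F] [NormedSpace ℝ F]
    [CompleteSpace F] {f : ℝ → F} {T e : ℝ} (hT : 0 ≤ T) (hf : IntegrableOn f (Icc 0 T))
    (he : 0 < e) :
    ∃ P : ℕ, 0 < P ∧ (∫ s in (0 : ℝ)..T, ‖f s‖) - e ≤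
      ∑ j ∈ Finset.range P, ‖∫ s in (j * (T / P) : ℝ)..((j + 1 : ℕ) * (T / P) : ℝ), f s‖ := by
  obtain ⟨φ, hφs, hφ, hφc, -⟩ := Integrable.exists_hasCompactSupport_integral_sub_le
    ((integrable_indicator_iff measurableSet_Icc).2 hf) (show 0 < e / 4 by positivity)
  have huc : UniformContinuous φ := hφs.uniformContinuous_of_continuous hφc
  -- The total error is 2 · e/4 from the L¹ approximation and 2ωT ≤ e/2 from the oscillation of `φ`;
  -- `T + 1` avoids dividing by zero.
  set ω := e / (4 * (T + 1)) with hω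
  have hωpos : 0 < ω := by positivity
  obtain ⟨δ, hδ, huδ⟩ := Metric.uniformContinuous_iff.1 huc ω hωpos
  obtain ⟨P, hP⟩ := exists_nat_gt (T / δ)
  have hP0 : 0 < P := by
    have : (0 : ℝ) < P := lt_of_le_of_lt (by positivity) hP
    exact_mod_cast this
  have hP0' : (0 : ℝ) < P := by exact_mod_cast hP0
  have hstep : T / P < δ := by
    rw [div_lt_iff₀ hδ] at hP
    rw [div_lt_iff₀ hP0']
    linarith
  set τ : ℕ → ℝ := fun j => j * (T / P) with hτ
  have hτmem : ∀ j ≤ P, τ j ∈ Icc 0 T := by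
    intro j hj
    have hj' : (j : ℝ) ≤ P := by exact_mod_cast hj
    refine ⟨by positivity, ?_⟩
    calc (j : ℝ) * (T / P) ≤ P * (T / P) := by gcongr
      _ = T := by field_simp
  have hτsub : ∀ j, τ (j + 1) - τ j = T / P := by intro j; simp only [hτ]; push_cast; ring
  have hint : ∀ j < P, IntervalIntegrable f volume (τ j) (τ (j + 1)) := fun j hj =>
    intervalIntegrable_iff.2 (hf.mono_set (uIoc_subset_uIcc.trans
      (uIcc_subset_Icc (hτmem j hj.le) (hτmem (j + 1) hj))))
  have hτ0 : τ 0 = 0 := by simp [hτ]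
  have hτP : τ P = T := by simp only [hτ]; field_simp
  have hmain : ∀ j ∈ Finset.range P, ∫ s in τ j..τ (j + 1), ‖f s‖ ≤
      ‖∫ s in τ j..τ (j + 1), f s‖ + (2 * ∫ s in τ j..τ (j + 1), ‖f s - φ s‖)
        + 2 * ω * (T / P) := by
    intro j hj
    rw [Finset.mem_range] at hj
    have hle : τ j ≤ τ (j + 1) := by
      have : 0 ≤ T / P := by positivity
      linarith [hτsub j]
    rw [← hτsub j]
    refine integral_norm_le_of_norm_sub_le hle (hint j hj) hφc fun s hs => ?_
    rw [← dist_eq_norm]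
    refine (huδ ?_).le
    rw [Real.dist_eq, abs_of_nonneg (by linarith [hs.1])]
    linarith [hs.2, hτsub j]
  have hsum := Finset.sum_le_sum hmain
  rw [Finset.sum_add_distrib, Finset.sum_add_distrib, ← Finset.mul_sum,
    intervalIntegral.sum_integral_adjacent_intervals (fun j hj => (hint j hj).norm),
    intervalIntegral.sum_integral_adjacent_intervals
      (fun j hj => ((hint j hj).sub (hφc.intervalIntegrable _ _)).norm), hτ0, hτP,
    Finset.sum_const, Finset.card_range, nsmul_eq_mul] at hsum
  have hφT : ∫ s in (0 : ℝ)..T, ‖f s - φ s‖ ≤ e / 4 := by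
    refine le_trans ?_ hφ
    rw [intervalIntegral.integral_of_le hT, ← integral_Icc_eq_integral_Ioc]
    have : ∫ s in Icc 0 T, ‖f s - φ s‖ = ∫ s in Icc 0 T, ‖(Icc 0 T).indicator f s - φ s‖ :=
      setIntegral_congr_fun measurableSet_Icc fun s hs => by simp only [indicator_of_mem hs]
    rw [this]
    refine setIntegral_le_integral ?_ (ae_of_all _ fun s => norm_nonneg _)
    exact (((integrable_indicator_iff measurableSet_Icc).2 hf).sub
      (hφc.integrable_of_hasCompactSupport hφs)).norm
  have hωT : (P : ℝ) * (2 * ω * (T / P)) ≤ e / 2 := by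
    have : (P : ℝ) * (2 * ω * (T / P)) = 2 * ω * T := by field_simp
    rw [this, hω]
    rw [show 2 * (e / (4 * (T + 1))) * T = e / 2 * (T / (T + 1)) by field_simp; ring]
    have : T / (T + 1) ≤ 1 := by rw [div_le_one (by positivity)]; linarith
    nlinarith
  exact ⟨P, hP0, by simp only [hτ] at hsum; linarith⟩

/-! ### Separated subfamilies of a nearly geodesic sequence -/

/-- Greedy choice, with `R` bounding the distances from `p a` reached so far: an index is kept when
it exceeds `R` by at least h/2, which separates it from all earlier points. A kept index raises `R`
by at most h, a discarded one by h/2, so each discard wastes h/2 of the available length. -/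
theorem exists_separated {X : Type*} [PseudoMetricSpace X] (p : ℕ → X) {h : ℝ} (hh : 0 ≤ h)
    {a b : ℕ} (hab : a ≤ b) (hp : ∀ i, i < b → dist (p i) (p (i + 1)) ≤ h) :
    ∃ G ⊆ Finset.Ioc a b, (∀ i ∈ G, ∀ j ∈ G, i ≠ j → h / 2 ≤ dist (p i) (p j)) ∧
      (h / 2) * (Finset.Ioc a b \ G).card ≤ ((b : ℝ) - a) * h - dist (p a) (p b) := by
  suffices H : ∃ G ⊆ Finset.Ioc a b, ∃ R, (∀ i, a ≤ i → i ≤ b → dist (p a) (p i) ≤ R) ∧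
      (∀ i ∈ G, ∀ j ∈ G, i ≠ j → h / 2 ≤ dist (p i) (p j)) ∧
      (h / 2) * (Finset.Ioc a b \ G).card + R ≤ ((b : ℝ) - a) * h by
    obtain ⟨G, hG, R, hR, hs, hc⟩ := H
    exact ⟨G, hG, hs, by linarith [hR b hab le_rfl]⟩
  induction b, hab using Nat.le_induction with
  | base =>
    refine ⟨∅, Finset.empty_subset _, 0, fun i h1 h2 => ?_, by simp, by simp⟩
    obtain rfl := le_antisymm h1 h2
    simp
  | succ b hab ih =>
    obtain ⟨G, hG, R, hR, hs, hc⟩ := ih fun i hi => hp i (hi.trans b.lt_succ_self)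
    have hnext : dist (p a) (p (b + 1)) ≤ R + h :=
      (dist_triangle _ (p b) _).trans (add_le_add (hR b hab le_rfl) (hp b b.lt_succ_self))
    have hIoc : Finset.Ioc a (b + 1) = insert (b + 1) (Finset.Ioc a b) := by
      ext i; simp only [Finset.mem_Ioc, Finset.mem_insert]; omega
    have hnot : b + 1 ∉ Finset.Ioc a b := by simp
    have hcases : ∀ i, i ≤ b + 1 → i ≤ b ∨ i = b + 1 := by omega
    rcases le_or_gt (R + h / 2) (dist (p a) (p (b + 1))) with hgood | hbad
    · have hsep : ∀ i ∈ G, h / 2 ≤ dist (p i) (p (b + 1)) := by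
        intro i hi
        have hi' := Finset.mem_Ioc.1 (hG hi)
        have := hR i hi'.1.le hi'.2
        have := dist_triangle (p a) (p i) (p (b + 1))
        linarith
      refine ⟨insert (b + 1) G, ?_, dist (p a) (p (b + 1)), ?_, ?_, ?_⟩
      · rw [hIoc]; exact Finset.insert_subset_insert _ hG
      · intro i h1 h2
        rcases hcases i h2 with h3 | rfl
        · linarith [hR i h1 h3]
        · exact le_rfl
      · intro i hi j hj hij
        rw [Finset.mem_insert] at hi hj
        rcases hi with rfl | hi <;> rcases hj with rfl | hj
        · exact absurd rfl hij
        · rw [dist_comm]; exact hsep j hj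
        · exact hsep i hi
        · exact hs i hi j hj hij
      · have : Finset.Ioc a (b + 1) \ insert (b + 1) G = Finset.Ioc a b \ G := by
          ext i
          simp only [Finset.mem_sdiff, Finset.mem_Ioc, Finset.mem_insert, not_or]
          constructor
          · rintro ⟨h1, h2, h3⟩; exact ⟨⟨h1.1, by omega⟩, h3⟩
          · rintro ⟨h1, h3⟩; exact ⟨⟨h1.1, by omega⟩, by omega, h3⟩
        rw [this]; push_cast; linarith
    · refine ⟨G, hG.trans (by rw [hIoc]; exact Finset.subset_insert _ _), R + h / 2, ?_, hs, ?_⟩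
      · intro i h1 h2
        rcases hcases i h2 with h3 | rfl
        · linarith [hR i h1 h3]
        · exact hbad.le
      · rw [hIoc, Finset.insert_sdiff_of_notMem _ fun h => hnot (hG h),
          Finset.card_insert_of_notMem (fun h => hnot (Finset.mem_sdiff.1 h).1)]
        push_cast; linarith

/-- Points of different pieces may be close to each other, so the greedy choice is made in each
piece separately and the wasted lengths are added. -/
theorem exists_separated_pieces {X : Type*} [PseudoMetricSpace X] (p : ℕ → X) {h : ℝ}
    (hh : 0 ≤ h) {M P : ℕ} (hp : ∀ i, i < M → dist (p i) (p (i + 1)) ≤ h) (a : ℕ → ℕ)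
    (ha0 : a 0 = 0) (haP : a P = M) (ha : ∀ j < P, a j ≤ a (j + 1)) :
    ∃ G : ℕ → Finset ℕ, (∀ j < P, G j ⊆ Finset.Ioc 0 M) ∧
      (∀ j < P, ∀ i ∈ G j, ∀ i' ∈ G j, i ≠ i' → h / 2 ≤ dist (p i) (p i')) ∧
      (h / 2) * (Finset.Ioc 0 M \ (Finset.range P).biUnion G).card ≤
        M * h - ∑ j ∈ Finset.range P, dist (p (a j)) (p (a (j + 1))) := by
  have haM : ∀ i j, i ≤ j → j ≤ P → a i ≤ a j := by
    intro i j hij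
    induction j, hij using Nat.le_induction with
    | base => exact fun _ => le_rfl
    | succ j hij ih => exact fun hj => (ih (by omega)).trans (ha j hj)
  have key : ∀ j, ∃ G : Finset ℕ, j < P → G ⊆ Finset.Ioc (a j) (a (j + 1)) ∧
      (∀ i ∈ G, ∀ i' ∈ G, i ≠ i' → h / 2 ≤ dist (p i) (p i')) ∧
      (h / 2) * (Finset.Ioc (a j) (a (j + 1)) \ G).card ≤
        ((a (j + 1) : ℝ) - a j) * h - dist (p (a j)) (p (a (j + 1))) := by
    intro j
    by_cases hj : j < P
    · obtain ⟨G, h1, h2, h3⟩ := exists_separated p hh (ha j hj) fun i hi => hp i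
        (hi.trans_le (haP ▸ haM (j + 1) P hj le_rfl))
      exact ⟨G, fun _ => ⟨h1, h2, h3⟩⟩
    · exact ⟨∅, fun h => absurd h hj⟩
  choose G hG using key
  refine ⟨G, fun j hj => (hG j hj).1.trans (Finset.Ioc_subset_Ioc (Nat.zero_le _)
    (haP ▸ haM (j + 1) P hj le_rfl)), fun j hj => (hG j hj).2.1, ?_⟩
  have hcover : Finset.Ioc 0 M \ (Finset.range P).biUnion G ⊆
      (Finset.range P).biUnion fun j => Finset.Ioc (a j) (a (j + 1)) \ G j := by
    intro i hi
    rw [Finset.mem_sdiff, Finset.mem_Ioc, Finset.mem_biUnion] at hi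
    obtain ⟨⟨hi0, hiM⟩, hiG⟩ := hi
    have hex : ∃ j, j < P ∧ i ≤ a (j + 1) := by
      rcases Nat.eq_zero_or_pos P with rfl | hP
      · omega
      · exact ⟨P - 1, by omega, by rw [Nat.sub_add_cancel hP, haP]; exact hiM⟩
    classical
    obtain ⟨hj, hj'⟩ := Nat.find_spec hex
    set j := Nat.find hex
    have hlt : a j < i := by
      rcases Nat.eq_zero_or_pos j with h0 | h0
      · rw [h0, ha0]; exact hi0
      · have := Nat.find_min hex (m := j - 1) (by omega)
        rw [Nat.sub_add_cancel h0] at this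
        by_contra hcon
        exact this ⟨by omega, by omega⟩
    rw [Finset.mem_biUnion]
    refine ⟨j, Finset.mem_range.2 hj, Finset.mem_sdiff.2 ⟨Finset.mem_Ioc.2 ⟨hlt, hj'⟩, ?_⟩⟩
    exact fun h => hiG ⟨j, Finset.mem_range.2 hj, h⟩
  have hcard : ((Finset.Ioc 0 M \ (Finset.range P).biUnion G).card : ℝ) ≤
      ∑ j ∈ Finset.range P, ((Finset.Ioc (a j) (a (j + 1)) \ G j).card : ℝ) := by
    exact_mod_cast (Finset.card_le_card hcover).trans Finset.card_biUnion_le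
  calc (h / 2) * ((Finset.Ioc 0 M \ (Finset.range P).biUnion G).card : ℝ)
      ≤ (h / 2) * ∑ j ∈ Finset.range P, ((Finset.Ioc (a j) (a (j + 1)) \ G j).card : ℝ) := by
        gcongr
    _ ≤ ∑ j ∈ Finset.range P,
          (((a (j + 1) : ℝ) - a j) * h - dist (p (a j)) (p (a (j + 1)))) := by
        rw [Finset.mul_sum]
        exact Finset.sum_le_sum fun j hj => (hG j (Finset.mem_range.1 hj)).2.2
    _ = _ := by
        rw [Finset.sum_sub_distrib, ← Finset.sum_mul, Finset.sum_range_sub (fun j => (a j : ℝ)),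
          haP, ha0]
        simp

/-! ### The length function of a trajectory -/

namespace System

variable {N m : ℕ} {S : System N m}

/-- `A t` is the length of `x` on `[0,t]`. -/
structure IsLengthFunction (S : System N m) (x : ℝ → E N) (T : ℝ) (A : ℝ → ℝ) : Prop where
  zero : A 0 = 0
  continuousOn : ContinuousOn A (Icc 0 T)
  mono : MonotoneOn A (Icc 0 T)
  arcLength_eq : ∀ a b, 0 ≤ a → a ≤ b → b ≤ T → arcLength x a b = ENNReal.ofReal (A b - A a)
  chord : ∀ e > 0, ∃ P : ℕ, 0 < P ∧
    A T - e ≤ ∑ j ∈ Finset.range P, ‖x ((j + 1 : ℕ) * (T / P)) - x (j * (T / P))‖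

theorem IsTrajectory.exists_isLengthFunction {x : ℝ → E N} {T : ℝ} (hx : S.IsTrajectory x T) :
    ∃ A, S.IsLengthFunction x T A := by
  obtain ⟨f, hf, h⟩ := hx.exists_velocity
  have h0 : (0 : ℝ) ∈ Icc 0 T := ⟨le_rfl, hx.1⟩
  have hint : ∀ a ∈ Icc 0 T, ∀ b ∈ Icc 0 T, IntervalIntegrable (fun s => ‖f s‖) volume a b :=
    fun a ha b hb => (intervalIntegrable_of_Icc hf ha hb).norm
  have hsub : ∀ a ∈ Icc 0 T, ∀ b ∈ Icc 0 T, (∫ s in (0 : ℝ)..b, ‖f s‖) -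
      (∫ s in (0 : ℝ)..a, ‖f s‖) = ∫ s in a..b, ‖f s‖ := fun a ha b hb =>
    intervalIntegral.integral_interval_sub_left (hint 0 h0 b hb) (hint 0 h0 a ha)
  refine ⟨fun t => ∫ s in (0 : ℝ)..t, ‖f s‖, by simp, ?_, ?_, ?_, ?_⟩
  · have := intervalIntegral.continuousOn_primitive_interval (a := 0) (b := T) (μ := volume)
      (f := fun s => ‖f s‖) (by rw [uIcc_of_le hx.1]; exact hf.norm)
    rwa [uIcc_of_le hx.1] at this
  · intro a ha b hb hab
    have := hsub a ha b hb
    have h2 : 0 ≤ ∫ s in a..b, ‖f s‖ :=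
      intervalIntegral.integral_nonneg hab fun _ _ => norm_nonneg _
    simp only
    linarith
  · intro a b ha hab hb
    rw [arcLength_eq_ofReal hf h ha hab hb,
      hsub a ⟨ha, hab.trans hb⟩ b ⟨ha.trans hab, hb⟩]
  · intro e he
    obtain ⟨P, hP, hle⟩ := exists_integral_norm_le_sum hx.1 hf he
    refine ⟨P, hP, hle.trans (le_of_eq (Finset.sum_congr rfl fun j hj => ?_))⟩
    have hmem : ∀ j ≤ P, (j : ℝ) * (T / P) ∈ Icc 0 T := by
      intro j hj
      have hj' : (j : ℝ) ≤ P := by exact_mod_cast hj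
      have hT := hx.1
      have hP' : (0 : ℝ) < P := by exact_mod_cast hP
      refine ⟨by positivity, ?_⟩
      calc (j : ℝ) * (T / P) ≤ P * (T / P) := by gcongr
        _ = T := by field_simp
    have hj := Finset.mem_range.1 hj
    rw [sub_eq_integral hf h (hmem j hj.le) (hmem (j + 1) hj)]

namespace IsLengthFunction

variable {x : ℝ → E N} {T : ℝ} {A : ℝ → ℝ}

theorem dist_le (hA : S.IsLengthFunction x T A) (hx : S.IsTrajectory x T) {s t : ℝ}
    (hs : s ∈ Icc 0 T) (ht : t ∈ Icc 0 T) :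
    S.dist (x s) (x t) ≤ ENNReal.ofReal |A s - A t| := by
  wlog hst : s ≤ t generalizing s t
  · rw [dist_comm, abs_sub_comm]; exact this ht hs (le_of_not_ge hst)
  refine (hx.dist_le_arcLength hs.1 hst ht.2).trans ?_
  rw [hA.arcLength_eq s t hs.1 hst ht.2, abs_sub_comm]
  exact ENNReal.ofReal_le_ofReal (le_abs_self _)

theorem norm_sub_le (hA : S.IsLengthFunction x T A) (hx : S.IsTrajectory x T) {s t : ℝ}
    (hs : s ∈ Icc 0 T) (ht : t ∈ Icc 0 T) : ‖x s - x t‖ ≤ |A s - A t| :=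
  (ENNReal.ofReal_le_ofReal_iff (abs_nonneg _)).1
    ((norm_sub_le_dist (S := S) _ _).trans (hA.dist_le hx hs ht))

/-- Intermediate values of `A`. Since `A` may be constant on intervals, the times are not unique; in
particular `t 0` need not be 0. -/
theorem exists_time (hA : S.IsLengthFunction x T A) (hx : S.IsTrajectory x T) (M : ℕ) :
    ∃ t : ℕ → ℝ, (∀ i, t i ∈ Icc 0 T) ∧ ∀ i ≤ M, 0 < M → A (t i) = i * (A T / M) := by
  have hT : (0 : ℝ) ∈ Icc 0 T := ⟨le_rfl, hx.1⟩
  have hAT : 0 ≤ A T := by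
    rw [← hA.zero]; exact hA.mono hT ⟨hx.1, le_rfl⟩ hx.1
  have : ∀ i : ℕ, ∃ t ∈ Icc 0 T, i ≤ M → 0 < M → A t = i * (A T / M) := by
    intro i
    by_cases hi : i ≤ M ∧ 0 < M
    · have hM : (0 : ℝ) < M := by exact_mod_cast hi.2
      have hmem : (i : ℝ) * (A T / M) ∈ Icc (A 0) (A T) := by
        rw [hA.zero]
        refine ⟨by positivity, ?_⟩
        calc (i : ℝ) * (A T / M) ≤ M * (A T / M) := by gcongr; exact hi.1
          _ = A T := by field_simp
      obtain ⟨t, ht, h⟩ := intermediate_value_Icc hx.1 hA.continuousOn hmem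
      exact ⟨t, ht, fun _ _ => h⟩
    · exact ⟨0, hT, fun h1 h2 => absurd ⟨h1, h2⟩ hi⟩
  choose t h1 h2 using this
  exact ⟨t, h1, h2⟩

/-- Equally spaced points along a trajectory are, up to a small proportion of them, distributed
among a bounded number of separated families. -/
theorem exists_separated_families (hA : S.IsLengthFunction x T A) (hx : S.IsTrajectory x T)
    (hAT : 0 < A T) {e : ℝ} (he : 0 < e) :
    ∃ P : ℕ, 0 < P ∧ ∀ (M : ℕ) (t : ℕ → ℝ), 0 < M → (∀ i, t i ∈ Icc 0 T) →
      (∀ i ≤ M, A (t i) = i * (A T / M)) →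
      ∃ G : ℕ → Finset ℕ, (∀ j < P, G j ⊆ Finset.Ioc 0 M) ∧
        (∀ j < P, ∀ i ∈ G j, ∀ i' ∈ G j, i ≠ i' → A T / M / 2 ≤ ‖x (t i) - x (t i')‖) ∧
        (A T / M / 2) * (Finset.Ioc 0 M \ (Finset.range P).biUnion G).card ≤
          e + 2 * P * (A T / M) := by
  obtain ⟨P, hP, hchord⟩ := hA.chord e he
  refine ⟨P, hP, fun M t hM ht hAt => ?_⟩
  have hM' : (0 : ℝ) < M := by exact_mod_cast hM
  have hP' : (0 : ℝ) < P := by exact_mod_cast hP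
  set h := A T / M with hh
  have hpos : 0 < h := by positivity
  have hMh : M * h = A T := by rw [hh]; field_simp
  set τ : ℕ → ℝ := fun j => j * (T / P) with hτ
  have hτmem : ∀ j ≤ P, τ j ∈ Icc 0 T := by
    intro j hj
    have hT := hx.1
    refine ⟨by positivity, ?_⟩
    calc (j : ℝ) * (T / P) ≤ P * (T / P) := by gcongr
      _ = T := by field_simp
  have hτP : τ P = T := by simp only [hτ]; field_simp
  -- The last marked point not beyond `τ j` in length; it is within h of `x (τ j)`.
  set a : ℕ → ℕ := fun j => ⌊A (τ j) / h⌋₊ with ha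
  have hAτ : ∀ j ≤ P, 0 ≤ A (τ j) := fun j hj => by
    rw [← hA.zero]; exact hA.mono ⟨le_rfl, hx.1⟩ (hτmem j hj) (hτmem j hj).1
  have hmono : ∀ j < P, a j ≤ a (j + 1) := by
    intro j hj
    refine Nat.floor_le_floor ?_
    gcongr
    refine hA.mono (hτmem j hj.le) (hτmem (j + 1) hj) ?_
    simp only [hτ]
    have hT := hx.1
    gcongr
    exact j.le_succ
  have ha0 : a 0 = 0 := by simp [ha, hτ, hA.zero]
  have haP : a P = M := by
    simp only [ha, hτP]
    rw [← hMh, mul_div_cancel_right₀ _ hpos.ne', Nat.floor_natCast]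
  have haM : ∀ j ≤ P, a j ≤ M := by
    intro j hj
    rw [← haP]
    refine Nat.floor_le_floor ?_
    gcongr
    refine hA.mono (hτmem j hj) (hτmem P le_rfl) ?_
    simp only [hτ]
    have hT := hx.1
    gcongr
  have hclose : ∀ j ≤ P, ‖x (t (a j)) - x (τ j)‖ ≤ h := by
    intro j hj
    refine (hA.norm_sub_le hx (ht _) (hτmem j hj)).trans ?_
    rw [hAt _ (haM j hj), abs_le]
    have h1 := Nat.floor_le (div_nonneg (hAτ j hj) hpos.le)
    have h2 := Nat.lt_floor_add_one (A (τ j) / h)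
    rw [le_div_iff₀ hpos] at h1
    rw [div_lt_iff₀ hpos] at h2
    constructor <;> linarith
  obtain ⟨G, h1, h2, h3⟩ := exists_separated_pieces (fun i => x (t i)) hpos.le (M := M) (P := P)
    (fun i hi => by
      rw [dist_eq_norm]
      refine (hA.norm_sub_le hx (ht _) (ht _)).trans ?_
      rw [hAt i hi.le, hAt (i + 1) hi, abs_le]
      push_cast
      constructor <;> linarith) a ha0 haP hmono
  refine ⟨G, h1, fun j hj i hi i' hi' hne => by simpa [dist_eq_norm] using h2 j hj i hi i' hi' hne,
    h3.trans ?_⟩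
  -- Moving both ends of a chord to marked points costs at most 2h, whence the term `2 * P * (A T /
  -- M)`.
  have hsum : ∑ j ∈ Finset.range P, ‖x ((j + 1 : ℕ) * (T / P)) - x (j * (T / P))‖ ≤
      ∑ j ∈ Finset.range P, (Dist.dist (x (t (a j))) (x (t (a (j + 1)))) + 2 * h) := by
    refine Finset.sum_le_sum fun j hj => ?_
    have hj := Finset.mem_range.1 hj
    have e1 := hclose j hj.le
    have e2 := hclose (j + 1) hj
    have e3 : x (τ (j + 1)) - x (τ j) = -(x (t (a (j + 1))) - x (τ (j + 1))) +
      (x (t (a j)) - x (τ j)) + (x (t (a (j + 1))) - x (t (a j))) := by abel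
    change ‖x (τ (j + 1)) - x (τ j)‖ ≤ _
    rw [e3, _root_.dist_comm, dist_eq_norm]
    refine (norm_add₃_le).trans ?_
    rw [norm_neg]
    linarith
  rw [Finset.sum_add_distrib, Finset.sum_const, Finset.card_range, nsmul_eq_mul] at hsum
  rw [hMh]
  linarith

end IsLengthFunction

end System

theorem exists_mem_Icc_castSucc_succ {k : ℕ} (hk : 0 < k) (τ : Fin (k + 1) → ℝ) {s : ℝ}
    (h0 : τ 0 ≤ s) (h1 : s ≤ τ (Fin.last k)) : ∃ j : Fin k, s ∈ Icc (τ j.castSucc) (τ j.succ) := by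
  induction k with
  | zero => exact absurd hk (lt_irrefl _)
  | succ k ih =>
    rcases le_or_gt (τ (Fin.last k).castSucc) s with h | h
    · exact ⟨Fin.last k, h, h1⟩
    · rcases Nat.eq_zero_or_pos k with rfl | hk'
      · exact absurd h (not_lt.2 h0)
      · obtain ⟨j, hj⟩ := ih hk' (fun j => τ j.castSucc) h0 h.le
        exact ⟨j.castSucc, hj⟩

/-! ### Deterministic criteria for tracing. -/

namespace System

variable {N m : ℕ} {S : System N m}

theorem mem_of_dist_ne_top {p q : E N} (h : S.dist p q ≠ ⊤) : q ∈ S.M := by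
  obtain ⟨x, T, hx, -, rfl, -⟩ := exists_trajectory_of_dist_lt (lt_top_iff_ne_top.2 h)
  exact hx.2.2.1 T ⟨hx.1, le_rfl⟩

/-- If both endpoints were farther than c, the two parts of the piece would have total length above
2c. -/
theorem IsTrajectory.dist_le_half {Y : ℝ → E N} {R a b s c : ℝ} (hY : S.IsTrajectory Y R)
    (ha : 0 ≤ a) (hb : b ≤ R) (hs : s ∈ Icc a b) (h : arcLength Y a b ≤ ENNReal.ofReal (2 * c)) :
    S.dist (Y s) (Y a) ≤ ENNReal.ofReal c ∨ S.dist (Y s) (Y b) ≤ ENNReal.ofReal c := by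
  by_contra! hcon
  obtain ⟨h1, h2⟩ := hcon
  have e1 := hY.dist_le_arcLength ha hs.1 (hs.2.trans hb)
  have e2 := hY.dist_le_arcLength (ha.trans hs.1) hs.2 hb
  rw [dist_comm] at h1
  have h3 := ENNReal.add_lt_add (h1.trans_le e1) (h2.trans_le e2)
  have h4 := h3.trans_le ((arcLength_add_le Y hs.1 hs.2).trans h)
  refine absurd h4 (not_lt.2 ?_)
  rw [two_mul]
  exact ENNReal.ofReal_add_le

section Tracing

variable {x : ℝ → E N} {T : ℝ} {A : ℝ → ℝ}

theorem IsLengthFunction.traces_of_eq_zero (hA : S.IsLengthFunction x T A)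
    (hx : S.IsTrajectory x T) (hAT : A T = 0) (ε : ℝ) {r : ℝ} {y : E N}
    (hy : S.dist (x 0) y ≤ ENNReal.ofReal r) :
    S.Traces x T ε r (k := 0) (fun _ => y) where
  gap j := j.elim0
  exists_connection κ hκ := exists_isConnection hκ _
    (mem_of_dist_ne_top (hy.trans_lt ENNReal.ofReal_lt_top).ne) fun j => j.elim0
  cost_and_tube := by
    refine ⟨1, one_pos, ?_⟩
    rintro Y R ⟨-, τ, -, h0, hR, hy', -⟩
    obtain rfl : R = 0 := by rw [← h0, ← hR]; rfl
    refine ⟨by rw [arcLength_self]; exact zero_le, fun s hs => ⟨0, ⟨le_rfl, hx.1⟩, ?_⟩⟩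
    obtain rfl : s = 0 := le_antisymm hs.2 hs.1
    have h1 := hy' 0
    rw [h0] at h1
    rw [dist_comm, h1]
    exact hy
  follows := by
    refine ⟨![0, T], ?_, rfl, rfl, ?_⟩
    · intro i j hij
      fin_cases i <;> fin_cases j <;> simp_all [hx.1]
    · intro j s hs
      have hs' : s ∈ Icc 0 T := by
        obtain rfl := Fin.fin_one_eq_zero j
        exact hs
      have h0 : (0 : ℝ) ∈ Icc 0 T := ⟨le_rfl, hx.1⟩
      have h1 : A s = 0 := by
        refine le_antisymm ?_ ?_
        · rw [← hAT]; exact hA.mono hs' ⟨hx.1, le_rfl⟩ hs'.2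
        · rw [← hA.zero]; exact hA.mono h0 hs' hs'.1
      have h2 := hA.dist_le hx h0 hs'
      rw [h1, hA.zero, sub_zero, abs_zero, ENNReal.ofReal_zero] at h2
      refine (dist_triangle y (x 0) (x s)).trans ?_
      rw [dist_comm y]
      exact (add_le_add hy h2).trans (by rw [add_zero])

/-- By the triangle inequality each gap is at most h plus the errors of its two waypoints. Summed
over all gaps, the excess cost is at most twice the total error; the strict inequality in `hsum`
leaves room for `κ`. -/
theorem IsLengthFunction.traces_of_close (hA : S.IsLengthFunction x T A)
    (hx : S.IsTrajectory x T) (hAT : 0 < A T) {ε r : ℝ} {M : ℕ} (hM : 0 < M)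
    (hr : A T / M ≤ r / 2) {t : ℕ → ℝ} (ht : ∀ i, t i ∈ Icc 0 T)
    (hAt : ∀ i ≤ M, A (t i) = i * (A T / M)) (y : Fin (M + 1) → E N) (err : ℕ → ℝ)
    (herr0 : ∀ i, 0 ≤ err i) (herr : ∀ i, err i ≤ r / 4)
    (hy : ∀ i : Fin (M + 1), S.dist (x (t i)) (y i) ≤ ENNReal.ofReal (err i))
    (hsum : 2 * ∑ i ∈ Finset.range (M + 1), err i < ε * A T) :
    S.Traces x T ε r y := by
  have hM' : (0 : ℝ) < M := by exact_mod_cast hM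
  set h := A T / M with hh
  have hpos : 0 < h := by positivity
  have hrpos : 0 < r := by linarith
  have hMh : M * h = A T := by rw [hh]; field_simp
  have hgap : ∀ j : Fin M, S.dist (y j.castSucc) (y j.succ) ≤
      ENNReal.ofReal (err j + h + err (j + 1)) := by
    intro j
    have e1 := hy j.castSucc
    have e2 := hy j.succ
    have e3 := hA.dist_le hx (ht j) (ht (j + 1))
    rw [hAt j j.2.le, hAt (j + 1) j.2] at e3
    have e4 : |(j : ℝ) * h - ((j + 1 : ℕ) : ℝ) * h| = h := by
      rw [abs_sub_comm]; push_cast; rw [add_mul, one_mul, add_sub_cancel_left, abs_of_pos hpos]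
    rw [e4] at e3
    rw [dist_comm] at e1
    rw [ENNReal.ofReal_add (add_nonneg (herr0 _) hpos.le) (herr0 _),
      ENNReal.ofReal_add (herr0 _) hpos.le]
    refine (dist_triangle _ (x (t (j + 1))) _).trans (add_le_add ?_ e2)
    exact (dist_triangle _ (x (t j)) _).trans (add_le_add e1 e3)
  have hgapr : ∀ j : Fin M, S.dist (y j.castSucc) (y j.succ) ≤ ENNReal.ofReal r := fun j =>
    (hgap j).trans (ENNReal.ofReal_le_ofReal (by linarith [herr j, herr (j + 1)]))
  refine ⟨hgapr, fun κ hκ => exists_isConnection hκ _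
    (mem_of_dist_ne_top ((hy 0).trans_lt ENNReal.ofReal_lt_top).ne) fun j =>
    ((hgapr j).trans_lt ENNReal.ofReal_lt_top).ne, ?_, ?_⟩
  -- The first bound keeps the pieces short enough for the tube, the second spreads the slack in the
  -- cost over the M pieces.
  · set κ : ℝ := min (r / 2) ((ε * A T - 2 * ∑ i ∈ Finset.range (M + 1), err i) / M) with hκ
    have hκpos : 0 < κ := lt_min (by positivity) (div_pos (by linarith) hM')
    refine ⟨κ.toNNReal, Real.toNNReal_pos.2 hκpos, ?_⟩
    rintro Y R ⟨hY, τ, hτ, hτ0, hτR, hτy, hτd⟩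
    have hτd' : ∀ j : Fin M, arcLength Y (τ j.castSucc) (τ j.succ) ≤
        ENNReal.ofReal (err j + h + err (j + 1) + κ) := by
      intro j
      rw [ENNReal.ofReal_add (by linarith [herr0 j, herr0 (j + 1)]) hκpos.le]
      exact (hτd j).trans (add_le_add_left (hgap j) _)
    constructor
    · rw [hA.arcLength_eq 0 T le_rfl hx.1 le_rfl, hA.zero, sub_zero, ← hτ0, ← hτR,
        ← ENNReal.ofReal_mul' hAT.le]
      refine (arcLength_le_sum Y τ hτ).trans ((Finset.sum_le_sum fun j _ => hτd' j).trans ?_)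
      rw [← ENNReal.ofReal_sum_of_nonneg fun j _ => by
        linarith [herr0 j, herr0 (j + 1), hκpos]]
      refine ENNReal.ofReal_le_ofReal ?_
      rw [Fin.sum_univ_eq_sum_range (fun j => err j + h + err (j + 1) + κ), Finset.sum_add_distrib,
        Finset.sum_add_distrib, Finset.sum_add_distrib]
      have e1 := Finset.sum_range_succ err M
      have e2 := Finset.sum_range_succ' err M
      have e3 : M * κ ≤ ε * A T - 2 * ∑ i ∈ Finset.range (M + 1), err i := by
        rw [← le_div_iff₀' hM']; exact min_le_right _ _
      simp only [Finset.sum_const, Finset.card_range, nsmul_eq_mul]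
      linarith [herr0 0, herr0 M]
    · intro s hs
      obtain ⟨j, hj⟩ := exists_mem_Icc_castSucc_succ hM τ (s := s) (hτ0 ▸ hs.1) (hτR ▸ hs.2)
      -- r/4 + r/2 + r/4 + r/2 = 3r/2. Every point is thus within 3r/4 of a waypoint, which is
      -- itself within r/4 of `x`.
      have hlen : arcLength Y (τ j.castSucc) (τ j.succ) ≤ ENNReal.ofReal (2 * (3 / 4 * r)) :=
        (hτd' j).trans (ENNReal.ofReal_le_ofReal (by
          linarith [herr j, herr (j + 1), min_le_left (r / 2)
            ((ε * A T - 2 * ∑ i ∈ Finset.range (M + 1), err i) / M)]))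
      have hconcl : ∀ i : Fin (M + 1), S.dist (Y s) (Y (τ i)) ≤ ENNReal.ofReal (3 / 4 * r) →
          ∃ t ∈ Icc 0 T, S.dist (Y s) (x t) ≤ ENNReal.ofReal r := by
        intro i hi
        refine ⟨t i, ht i, (dist_triangle _ (Y (τ i)) _).trans ?_⟩
        have e1 := hy i
        rw [dist_comm, ← hτy i] at e1
        refine (add_le_add hi e1).trans ?_
        rw [← ENNReal.ofReal_add (by positivity) (herr0 _)]
        exact ENNReal.ofReal_le_ofReal (by linarith [herr i])
      rcases hY.dist_le_half (hτ0 ▸ hτ (Fin.zero_le _)) (hτR ▸ hτ (Fin.le_last _)) hj hlen with h | h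
      · exact hconcl _ h
      · exact hconcl _ h
  -- M + 1 waypoints need M + 2 interval ends. The first is reset to 0, and the last interval, from
  -- `t M` to `T`, carries no length when `0 < M`.
  · set tt : ℕ → ℝ := fun j => if j = 0 then 0 else if j = M + 1 then T else t j with htt
    have httm : ∀ j, tt j ∈ Icc 0 T := by
      intro j
      simp only [htt]
      split_ifs
      · exact ⟨le_rfl, hx.1⟩
      · exact ⟨hx.1, le_rfl⟩
      · exact ht j
    have hAtt : ∀ j ≤ M, A (tt j) = j * h := by
      intro j hj
      simp only [htt]
      split_ifs with h1 h2
      · simp [h1, hA.zero]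
      · omega
      · exact hAt j hj
    have httT : tt (M + 1) = T := by simp [htt]
    have hmono : ∀ i j, i ≤ j → j ≤ M + 1 → tt i ≤ tt j := by
      intro i j hij hj
      rcases hij.eq_or_lt with rfl | hlt
      · exact le_rfl
      rcases hj.eq_or_lt with rfl | hj
      · rw [httT]; exact (httm i).2
      by_contra hcon
      have := hA.mono (httm j) (httm i) (not_le.1 hcon).le
      rw [hAtt i (by omega), hAtt j (by omega)] at this
      have h2 : (i : ℝ) < j := by exact_mod_cast hlt
      nlinarith
    refine ⟨fun j => tt j, fun i j hij => hmono i j hij (by omega), by simp [htt], ?_, ?_⟩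
    · simpa using httT
    · intro j s hs
      simp only [Fin.val_castSucc, Fin.val_succ] at hs
      have hsm : s ∈ Icc 0 T := ⟨(httm _).1.trans hs.1, hs.2.trans (httm _).2⟩
      have hjM : (j : ℕ) ≤ M := by omega
      have e1 := hA.mono (httm j) hsm hs.1
      have e2 := hA.mono hsm (httm (j + 1)) hs.2
      rw [hAtt j hjM] at e1
      have e3 : A (tt (j + 1)) ≤ j * h + h := by
        rcases hjM.eq_or_lt with h1 | h1
        · rw [h1, httT, ← hMh]; linarith
        · rw [hAtt (j + 1) h1]; push_cast; linarith
      have e4 := hA.dist_le hx (ht j) hsm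
      rw [hAt j hjM] at e4
      have e5 : |(j : ℝ) * h - A s| ≤ h := by rw [abs_le]; constructor <;> linarith
      have e6 := hy j
      rw [dist_comm] at e6
      refine (dist_triangle _ (x (t j)) _).trans ((add_le_add e6 e4).trans ?_)
      rw [← ENNReal.ofReal_add (herr0 _) (abs_nonneg _)]
      exact ENNReal.ofReal_le_ofReal (by linarith [herr j])

end Tracing

end System

/-! ### Independent samples -/

section Sampling

variable {X : Type*} [MeasurableSpace X] {ν : Measure X} [IsProbabilityMeasure ν]

/-- Independence and 1 - b ≤ exp(-b). -/
theorem pi_forall_notMem_le (n : ℕ) {B : Set X} (hB : MeasurableSet B) {b : ℝ}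
    (hb : ENNReal.ofReal b ≤ ν B) :
    Measure.pi (fun _ : Fin n => ν) {v | ∀ k, v k ∉ B} ≤ ENNReal.ofReal (Real.exp (-(n * b))) := by
  have h1 : {v : Fin n → X | ∀ k, v k ∉ B} = univ.pi fun _ => Bᶜ := by
    ext v; simp
  have h2 : ν Bᶜ ≤ ENNReal.ofReal (Real.exp (-b)) := by
    rw [prob_compl_eq_one_sub hB]
    refine (tsub_le_tsub_left hb 1).trans ?_
    rcases le_or_gt 0 b with h0 | h0
    · rw [← ENNReal.ofReal_one, ← ENNReal.ofReal_sub _ h0]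
      exact ENNReal.ofReal_le_ofReal (by linarith [Real.add_one_le_exp (-b)])
    · rw [ENNReal.ofReal_of_nonpos h0.le, tsub_zero, ← ENNReal.ofReal_one]
      exact ENNReal.ofReal_le_ofReal (Real.one_le_exp (by linarith))
  rw [h1, Measure.pi_pi, Finset.prod_const, Finset.card_univ, Fintype.card_fin]
  calc ν Bᶜ ^ n ≤ ENNReal.ofReal (Real.exp (-b)) ^ n := by gcongr
    _ = ENNReal.ofReal (Real.exp (-(n * b))) := by
        rw [← ENNReal.ofReal_pow (Real.exp_pos _).le, ← Real.exp_nat_mul, mul_neg]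

/-- Missing every member means missing their union, whose measure is the sum by disjointness. -/
theorem pi_forall_notMem_family_le (n : ℕ) {Q : ℕ → Set X} (hQ : ∀ i, MeasurableSet (Q i))
    {F : Finset ℕ} (hF : ∀ i ∈ F, ∀ j ∈ F, i ≠ j → Disjoint (Q i) (Q j)) {a c : ℝ} (hc : 0 ≤ c)
    (haF : a ≤ F.card) (hνQ : ∀ i ∈ F, ENNReal.ofReal c ≤ ν (Q i)) :
    Measure.pi (fun _ : Fin n => ν) {v | ∀ i ∈ F, ∀ k, v k ∉ Q i} ≤
      ENNReal.ofReal (Real.exp (-(n * (a * c)))) := by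
  have hm : ENNReal.ofReal (a * c) ≤ ν (⋃ i ∈ F, Q i) := by
    rw [measure_biUnion_finset hF fun i _ => hQ i]
    calc ENNReal.ofReal (a * c) ≤ ENNReal.ofReal (F.card * c) :=
          ENNReal.ofReal_le_ofReal (by gcongr)
      _ = ∑ _i ∈ F, ENNReal.ofReal c := by
          rw [ENNReal.ofReal_mul (by positivity)]; simp
      _ ≤ _ := Finset.sum_le_sum hνQ
  have hset : {v : Fin n → X | ∀ i ∈ F, ∀ k, v k ∉ Q i} = {v | ∀ k, v k ∉ ⋃ i ∈ F, Q i} := by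
    ext v
    simp only [mem_ofPred_eq, mem_iUnion, not_exists]
    exact ⟨fun h k i hi => h i hi k, fun h i hi k => h k i hi⟩
  rw [hset]
  exact pi_forall_notMem_le n (F.measurableSet_biUnion fun i _ => hQ i) hm

/-- Union bound: with high probability, all of the sets `B i` are hit by the samples, and no large
disjoint subfamily of the sets `Q i` is missed. -/
theorem pi_miss_le (n M : ℕ) {B Q : ℕ → Set X} (hB : ∀ i, MeasurableSet (B i))
    (hQ : ∀ i, MeasurableSet (Q i)) {a b c : ℝ} (hc : 0 ≤ c)
    (hνB : ∀ i, ENNReal.ofReal b ≤ ν (B i)) (hνQ : ∀ i, ENNReal.ofReal c ≤ ν (Q i)) :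
    Measure.pi (fun _ : Fin n => ν)
      {v | (∃ i ∈ Finset.range (M + 1), ∀ k, v k ∉ B i) ∨
        ∃ F ∈ (Finset.range (M + 1)).powerset,
          ((∀ i ∈ F, ∀ j ∈ F, i ≠ j → Disjoint (Q i) (Q j)) ∧ a ≤ F.card) ∧
            ∀ i ∈ F, ∀ k, v k ∉ Q i} ≤
      ENNReal.ofReal ((M + 1) * Real.exp (-(n * b)) +
        2 ^ (M + 1) * Real.exp (-(n * (a * c)))) := by
  classical
  set 𝓕 := (Finset.range (M + 1)).powerset.filter fun F =>
    (∀ i ∈ F, ∀ j ∈ F, i ≠ j → Disjoint (Q i) (Q j)) ∧ a ≤ F.card with h𝓕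
  have hsub : {v : Fin n → X | (∃ i ∈ Finset.range (M + 1), ∀ k, v k ∉ B i) ∨
        ∃ F ∈ (Finset.range (M + 1)).powerset,
          ((∀ i ∈ F, ∀ j ∈ F, i ≠ j → Disjoint (Q i) (Q j)) ∧ a ≤ F.card) ∧
            ∀ i ∈ F, ∀ k, v k ∉ Q i} ⊆
      (⋃ i ∈ Finset.range (M + 1), {v | ∀ k, v k ∉ B i}) ∪
        ⋃ F ∈ 𝓕, {v | ∀ i ∈ F, ∀ k, v k ∉ Q i} := by
    rintro v (⟨i, hi, h⟩ | ⟨F, hF, h1, h2⟩)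
    · exact .inl (mem_iUnion₂.2 ⟨i, hi, h⟩)
    · exact .inr (mem_iUnion₂.2 ⟨F, Finset.mem_filter.2 ⟨hF, h1⟩, h2⟩)
  refine (measure_mono hsub).trans ((measure_union_le _ _).trans ?_)
  rw [ENNReal.ofReal_add (by positivity) (by positivity)]
  refine add_le_add ?_ ?_
  · refine (measure_biUnion_finset_le _ _).trans
      ((Finset.sum_le_sum fun i _ => pi_forall_notMem_le n (hB i) (hνB i)).trans ?_)
    rw [Finset.sum_const, Finset.card_range, nsmul_eq_mul, ENNReal.ofReal_mul (by positivity)]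
    gcongr
    rw [← Nat.cast_add_one, ENNReal.ofReal_natCast]
  · refine (measure_biUnion_finset_le _ _).trans ((Finset.sum_le_sum fun F hF =>
      pi_forall_notMem_family_le n hQ (Finset.mem_filter.1 hF).2.1 hc (Finset.mem_filter.1 hF).2.2
        fun i _ => hνQ i).trans ?_)
    rw [Finset.sum_const, nsmul_eq_mul, ENNReal.ofReal_mul (by positivity)]
    gcongr
    have : 𝓕.card ≤ 2 ^ (M + 1) := by
      refine (Finset.card_filter_le _ _).trans ?_
      rw [Finset.card_powerset, Finset.card_range]
    have h2 : ((2 : ℝ) ^ (M + 1)) = ((2 ^ (M + 1) : ℕ) : ℝ) := by push_cast; rfl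
    rw [h2, ENNReal.ofReal_natCast]
    exact_mod_cast this

end Sampling

/-- An index that is not hit is 0, or was discarded by the greedy choice, or is a missed member of
one of the P families; the families lie in `Ioc 0 M`, so 0 is counted apart. -/
theorem card_filter_not_le {P M : ℕ} (hP : 0 < P) {G : ℕ → Finset ℕ} {hit : ℕ → Prop}
    [DecidablePred hit] {d : ℝ}
    (hcount : ∀ j < P, (((G j).filter fun i => ¬ hit i).card : ℝ) ≤ d / (8 * P)) :
    (((Finset.range (M + 1)).filter fun i => ¬ hit i).card : ℝ) ≤
      1 + (Finset.Ioc 0 M \ (Finset.range P).biUnion G).card + d / 8 := by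
  have hP' : (0 : ℝ) < P := by exact_mod_cast hP
  set bad := Finset.Ioc 0 M \ (Finset.range P).biUnion G with hbad
  have hsub : (Finset.range (M + 1)).filter (fun i => ¬ hit i) ⊆
      ({0} ∪ bad) ∪ (Finset.range P).biUnion fun j => (G j).filter fun i => ¬ hit i := by
    intro i hi
    obtain ⟨hi, hnh⟩ := Finset.mem_filter.1 hi
    rw [Finset.mem_range] at hi
    by_cases hex : ∃ j < P, i ∈ G j
    · obtain ⟨j, hj, hij⟩ := hex
      exact Finset.mem_union_right _ (Finset.mem_biUnion.2
        ⟨j, Finset.mem_range.2 hj, Finset.mem_filter.2 ⟨hij, hnh⟩⟩)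
    · refine Finset.mem_union_left _ (Finset.mem_union.2 ?_)
      rcases Nat.eq_zero_or_pos i with rfl | h0
      · exact .inl (Finset.mem_singleton_self _)
      · refine .inr (Finset.mem_sdiff.2 ⟨Finset.mem_Ioc.2 ⟨h0, by omega⟩, fun hm => ?_⟩)
        obtain ⟨j, hj, hij⟩ := Finset.mem_biUnion.1 hm
        exact hex ⟨j, Finset.mem_range.1 hj, hij⟩
  have h1 : (((Finset.range (M + 1)).filter fun i => ¬ hit i).card : ℝ) ≤
      1 + bad.card + ∑ j ∈ Finset.range P, (((G j).filter fun i => ¬ hit i).card : ℝ) := by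
    have := (Finset.card_le_card hsub).trans ((Finset.card_union_le _ _).trans
      (add_le_add (Finset.card_union_le _ _) Finset.card_biUnion_le))
    rw [Finset.card_singleton] at this
    exact_mod_cast this
  have h2 : ∑ j ∈ Finset.range P, (((G j).filter fun i => ¬ hit i).card : ℝ) ≤ d / 8 := by
    calc _ ≤ ∑ _j ∈ Finset.range P, d / (8 * P) :=
          Finset.sum_le_sum fun j hj => hcount j (Finset.mem_range.1 hj)
      _ = d / 8 := by
          rw [Finset.sum_const, Finset.card_range, nsmul_eq_mul]; field_simp
  linarith

/-! ### Boxes in the free space and the probability of failure. -/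

namespace System

variable {N m : ℕ} {S : System N m}

theorem measurableSet_free (Mobs : Set (E N)) : MeasurableSet (S.free Mobs) :=
  isClosed_closure.measurableSet.inter S.isOpen_M.measurableSet

theorem volume_free_pos {Mobs : Set (E N)} (hopen : IsOpen (S.M \ Mobs))
    (hne : (S.free Mobs).Nonempty) : 0 < volume (S.free Mobs) := by
  obtain ⟨q, hq⟩ := hne
  have h : (S.M \ Mobs).Nonempty := closure_nonempty_iff.1 ⟨q, hq.1⟩
  exact (hopen.measure_pos volume h).trans_le
    (measure_mono fun p hp => ⟨subset_closure hp, hp.1⟩)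

theorem isProbabilityMeasure_cond_free {Mobs : Set (E N)} (hopen : IsOpen (S.M \ Mobs))
    (hne : (S.free Mobs).Nonempty) (hvol : volume (S.free Mobs) ≠ ⊤) :
    IsProbabilityMeasure (ProbabilityTheory.cond volume (S.free Mobs)) :=
  ProbabilityTheory.cond_isProbabilityMeasure_of_finite (volume_free_pos hopen hne).ne' hvol

section Boxes

variable {aMin AMax σMin θMin : ℝ}

/-- Boxes around the points of a trajectory with clearance, with a uniform bound on the radius. -/
theorem Assumptions.exists_boxes (hS : S.Assumptions aMin AMax σMin θMin) (hN : 0 < N)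
    {Mobs : Set (E N)} {x : ℝ → E N} {T : ℝ} (hx : S.IsTrajectory x T)
    {δ : ℝ} (hδ : 0 < δ) (hclear : S.StrongClearance Mobs δ x T) :
    ∃ ρ₀ > 0, ∀ t ∈ Icc 0 T, ∃ Q : ℝ → Set (E N), ∀ ρ, 0 ≤ ρ → ρ ≤ ρ₀ →
      MeasurableSet (Q ρ) ∧ Q ρ ⊆ S.free Mobs ∧
      volume (Q ρ) = ENNReal.ofReal (2 ^ N * ρ ^ S.homDim (x 0)) ∧
      ∀ q ∈ Q ρ, S.dist (x t) q ≤ ENNReal.ofReal (AMax * ρ) := by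
  have hA := hS.AMax_pos
  obtain ⟨c, hc, hcM⟩ := (isCompact_Icc.image_of_continuousOn hx.2.1).exists_cthickening_subset_open
    S.isOpen_M (image_subset_iff.2 hx.2.2.1)
  have hball : ∀ t ∈ Icc 0 T, Metric.closedBall (x t) c ⊆ S.M := fun t ht =>
    (Metric.closedBall_subset_cthickening (mem_image_of_mem x ht) c).trans hcM
  -- A common bound on the d-radius of the boxes: `c` keeps them in `M`, `σMin / 2` within reach of
  -- the ball-box estimate, and `δ / 2` off the obstacles.
  set κ := min c (min (σMin / 2) (δ / 2)) with hκ
  have hκ0 : 0 < κ := lt_min hc (lt_min (half_pos hS.σMin_pos) (half_pos hδ))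
  have hκc : κ ≤ c := min_le_left _ _
  have hκσ : κ ≤ σMin / 2 := (min_le_right _ _).trans (min_le_left _ _)
  have hκδ : κ ≤ δ / 2 := (min_le_right _ _).trans (min_le_right _ _)
  have hAκ : AMax * (κ / AMax) = κ := mul_div_cancel₀ _ hA.ne'
  refine ⟨κ / AMax, by positivity, fun t ht => ?_⟩
  have hMt : Metric.closedBall (x t) (AMax * (κ / AMax)) ⊆ S.M := by
    rw [hAκ]; exact (Metric.closedBall_subset_closedBall hκc).trans (hball t ht)
  obtain ⟨Q, hQ⟩ := hS.exists_box hN (hx.2.2.1 t ht) (ρ₀ := κ / AMax)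
    (by rw [hAκ]; linarith [hS.σMin_pos]) hMt
  refine ⟨Q, fun ρ h0 h1 => ?_⟩
  obtain ⟨hm, hv, hd⟩ := hQ ρ h0 h1
  refine ⟨hm, fun q hq => ?_, by rw [hv, homDim_eq_of_isTrajectory hS.regular hx ht], hd⟩
  have hle : AMax * ρ ≤ κ := by rw [← hAκ]; gcongr
  have hn : ‖x t - q‖ ≤ κ := by
    refine le_trans ?_ hle
    exact (ENNReal.ofReal_le_ofReal_iff (by positivity)).1
      ((norm_sub_le_dist (S := S) _ _).trans (hd q hq))
  have hqM : q ∈ S.M := hMt (by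
    rw [hAκ, Metric.mem_closedBall, dist_eq_norm, norm_sub_rev]; exact hn)
  refine ⟨subset_closure ⟨hqM, fun hqo => ?_⟩, hqM⟩
  linarith [(hclear t ht).2 q hqo]

end Boxes

section Failure

variable {x : ℝ → E N} {T : ℝ} {A : ℝ → ℝ} {Mobs : Set (E N)} {xinit : E N}

theorem IsLengthFunction.measure_compl_traceEvent_le_of_eq_zero
    (hA : S.IsLengthFunction x T A) (hx : S.IsTrajectory x T) (hAT : A T = 0) (ε : ℝ) {r b : ℝ}
    (hr : 0 ≤ r)
    [IsProbabilityMeasure (ProbabilityTheory.cond volume (S.free Mobs))] (n : ℕ) {B : Set (E N)}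
    (hB : MeasurableSet B) (hb : ENNReal.ofReal b ≤ ProbabilityTheory.cond volume (S.free Mobs) B)
    (hd : ∀ q ∈ B, S.dist (x 0) q ≤ ENNReal.ofReal (r / 4)) :
    S.sampleFree Mobs n (S.traceEvent xinit x T ε r n)ᶜ ≤
      ENNReal.ofReal (Real.exp (-(n * b))) := by
  refine (measure_mono ?_).trans (pi_forall_notMem_le n hB hb)
  intro v hv k hk
  refine hv ?_
  by_cases h0 : x 0 = xinit
  · refine ⟨0, fun _ => xinit, fun _ => mem_insert _ _, ?_, fun _ => rfl⟩
    refine hA.traces_of_eq_zero hx hAT ε ?_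
    rw [← h0, dist_self (hx.2.2.1 0 ⟨le_rfl, hx.1⟩)]
    exact zero_le
  · refine ⟨0, fun _ => v k, fun _ => mem_insert_of_mem _ (mem_range_self k), ?_,
      fun h => absurd h h0⟩
    exact hA.traces_of_eq_zero hx hAT ε
      ((hd _ hk).trans (ENNReal.ofReal_le_ofReal (by linarith)))

theorem IsLengthFunction.measure_compl_traceEvent_le
    (hA : S.IsLengthFunction x T A) (hx : S.IsTrajectory x T) (hAT : 0 < A T) {ε : ℝ} (hε : 0 < ε)
    {P : ℕ} (hP : 0 < P)
    (hfam : ∀ (M : ℕ) (t : ℕ → ℝ), 0 < M → (∀ i, t i ∈ Icc 0 T) →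
      (∀ i ≤ M, A (t i) = i * (A T / M)) →
      ∃ G : ℕ → Finset ℕ, (∀ j < P, G j ⊆ Finset.Ioc 0 M) ∧
        (∀ j < P, ∀ i ∈ G j, ∀ i' ∈ G j, i ≠ i' → A T / M / 2 ≤ ‖x (t i) - x (t i')‖) ∧
        (A T / M / 2) * (Finset.Ioc 0 M \ (Finset.range P).biUnion G).card ≤
          ε * A T / 32 + 2 * P * (A T / M))
    {β : ℝ} (hβ0 : 0 < β) (hβ1 : β ≤ 1 / 8) (hβε : β ≤ ε / 32)
    {r : ℝ} (hr : 0 < r) (hrL : r ≤ A T) (hrP : r * (3 * P + 1 / 2) ≤ ε * A T / 8)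
    [IsProbabilityMeasure (ProbabilityTheory.cond volume (S.free Mobs))] {b c : ℝ} (hc : 0 ≤ c)
    (hbox : ∀ t ∈ Icc 0 T, ∃ B Q : Set (E N), MeasurableSet B ∧ MeasurableSet Q ∧
      ENNReal.ofReal b ≤ ProbabilityTheory.cond volume (S.free Mobs) B ∧
      ENNReal.ofReal c ≤ ProbabilityTheory.cond volume (S.free Mobs) Q ∧
      (∀ q ∈ B, S.dist (x t) q ≤ ENNReal.ofReal (r / 4)) ∧
      ∀ q ∈ Q, S.dist (x t) q ≤ ENNReal.ofReal (β * r / 4)) (n : ℕ) :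
    S.sampleFree Mobs n (S.traceEvent xinit x T ε r n)ᶜ ≤
      ENNReal.ofReal ((⌈2 * A T / r⌉₊ + 1) * Real.exp (-(n * b)) + 2 ^ (⌈2 * A T / r⌉₊ + 1) *
        Real.exp (-(n * (ε * ⌈2 * A T / r⌉₊ / (8 * P) * c)))) := by
  classical
  set M := ⌈2 * A T / r⌉₊ with hMdef
  have hM : 0 < M := Nat.ceil_pos.2 (by positivity)
  have hM' : (0 : ℝ) < M := by exact_mod_cast hM
  have hP' : (0 : ℝ) < P := by exact_mod_cast hP
  set h := A T / M with hh
  have hpos : 0 < h := by positivity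
  have hMh : M * h = A T := by rw [hh]; field_simp
  have hMge : 2 * A T ≤ M * r := by
    have := Nat.le_ceil (2 * A T / r)
    rwa [div_le_iff₀ hr] at this
  have hMr : M * r ≤ 3 * A T := by
    have := (Nat.ceil_lt_add_one (show 0 ≤ 2 * A T / r by positivity)).le
    rw [div_add_one hr.ne', le_div_iff₀ hr] at this
    linarith
  have hhr : h ≤ r / 2 := by
    rw [hh, div_le_iff₀ hM']; linarith
  have hhr' : r / 3 ≤ h := by
    rw [hh, le_div_iff₀ hM']; linarith
  obtain ⟨t, ht, hAt⟩ := hA.exists_time hx M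
  replace hAt : ∀ i ≤ M, A (t i) = i * h := fun i hi => hAt i hi hM
  obtain ⟨G, hG, hGsep, hGcard⟩ := hfam M t hM ht hAt
  simp only [← hh] at hGsep hGcard
  choose B Q hB hQ hνB hνQ hBd hQd using fun i => hbox (t i) (ht i)
  refine (measure_mono ?_).trans (pi_miss_le (ν := ProbabilityTheory.cond volume (S.free Mobs))
    n M hB hQ hc hνB hνQ)
  intro v hv
  by_contra hcon
  apply hv
  simp only [mem_ofPred_eq, not_or, not_exists, not_and, not_forall, not_not] at hcon
  obtain ⟨hhitB, hmiss⟩ := hcon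
  have hβr : β * r ≤ r / 8 := by
    calc β * r ≤ 1 / 8 * r := by gcongr
      _ = r / 8 := by ring
  -- The centres are at least h/2 ≥ r/6 apart, while the Euclidean radii are at most βr/4 ≤ r/32.
  have hdisj : ∀ j < P, ∀ i ∈ G j, ∀ i' ∈ G j, i ≠ i' → Disjoint (Q i) (Q i') := by
    intro j hj i hi i' hi' hne
    rw [Set.disjoint_left]
    intro q hq hq'
    have e1 := hGsep j hj i hi i' hi' hne
    have hb : ∀ i, q ∈ Q i → ‖x (t i) - q‖ ≤ β * r / 4 := fun i hi =>
      (ENNReal.ofReal_le_ofReal_iff (by positivity)).1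
        ((norm_sub_le_dist (S := S) _ _).trans (hQd i q hi))
    have e2 := hb i hq
    have e3 := hb i' hq'
    have e4 : ‖x (t i) - x (t i')‖ ≤ ‖x (t i) - q‖ + ‖q - x (t i')‖ :=
      norm_sub_le_norm_sub_add_norm_sub _ _ _
    rw [norm_sub_rev q] at e4
    linarith
  -- Discarded indices count as not hit, even when their small box contains a sample; they use the
  -- large box.
  set hit : ℕ → Prop := fun i => (∃ j < P, i ∈ G j) ∧ ∃ k, v k ∈ Q i with hhit
  have hcount : ∀ j < P, (((G j).filter fun i => ¬ hit i).card : ℝ) ≤ ε * M / (8 * P) := by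
    intro j hj
    by_contra hlt
    have hsub : (G j).filter (fun i => ¬ hit i) ⊆ G j := Finset.filter_subset _ _
    obtain ⟨i, hi, k, hk⟩ := hmiss ((G j).filter fun i => ¬ hit i)
      (Finset.mem_powerset.2 fun i hi => by
        have := Finset.mem_Ioc.1 (hG j hj (hsub hi))
        exact Finset.mem_range.2 (by omega))
      ⟨fun i hi i' hi' => hdisj j hj i (hsub hi) i' (hsub hi'), (not_le.1 hlt).le⟩
    exact (Finset.mem_filter.1 hi).2 ⟨⟨j, hj, hsub hi⟩, k, hk⟩
  set bad := Finset.Ioc 0 M \ (Finset.range P).biUnion G with hbad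
  have hunhit : (((Finset.range (M + 1)).filter fun i => ¬ hit i).card : ℝ) ≤
      1 + bad.card + ε * M / 8 := by
    exact card_filter_not_le hP hcount
  set err : ℕ → ℝ := fun i => if hit i then β * r / 4 else r / 4 with herr
  have hchoice : ∀ i : Fin (M + 1), ∃ q ∈ insert xinit (range v),
      S.dist (x (t i)) q ≤ ENNReal.ofReal (err i) ∧ (x 0 = xinit → i = 0 → q = xinit) := by
    intro i
    by_cases h0 : x 0 = xinit ∧ i = 0
    -- At the start `xinit` itself serves as the waypoint, at distance 0 from `x (t 0)`.
    · refine ⟨xinit, mem_insert _ _, ?_, fun _ _ => rfl⟩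
      have e1 := hA.dist_le hx (ht i) ⟨le_rfl, hx.1⟩
      rw [h0.2, hA.zero, Fin.val_zero, hAt 0 (Nat.zero_le _)] at e1
      rw [h0.2, ← h0.1]
      refine e1.trans ?_
      simp
    · have himp : ∀ q, (x 0 = xinit → i = 0 → q = xinit) := fun q h1 h2 => absurd ⟨h1, h2⟩ h0
      by_cases hi : hit i
      · obtain ⟨k, hk⟩ := hi.2
        refine ⟨v k, mem_insert_of_mem _ (mem_range_self k), ?_, himp _⟩
        simp only [herr, if_pos hi]
        exact hQd i _ hk
      · obtain ⟨k, hk⟩ := hhitB i (Finset.mem_range.2 i.2)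
        refine ⟨v k, mem_insert_of_mem _ (mem_range_self k), ?_, himp _⟩
        simp only [herr, if_neg hi]
        exact hBd i _ hk
  choose y hyV hyd hy0 using hchoice
  refine ⟨M, y, hyV, ?_, fun h => hy0 0 h rfl⟩
  refine hA.traces_of_close hx hAT hM hhr ht hAt y err ?_ ?_ hyd ?_
  · intro i
    simp only [herr]
    split_ifs <;> positivity
  · intro i
    simp only [herr]
    split_ifs
    · linarith
    · exact le_rfl
  -- In units of ε c(x), the total error is at most 1/32 (all small errors) + 3/64 and 1/16
  -- (discarded indices, index 0 and the terms in P) + 3/32 (missed members), that is 15/64 < 1/2.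
  · have hle : ∑ i ∈ Finset.range (M + 1), err i ≤
        (M + 1) * (β * r / 4) + r / 4 * ((Finset.range (M + 1)).filter fun i => ¬ hit i).card := by
      calc ∑ i ∈ Finset.range (M + 1), err i
          ≤ ∑ i ∈ Finset.range (M + 1), (β * r / 4 + if ¬ hit i then r / 4 else 0) := by
            refine Finset.sum_le_sum fun i _ => ?_
            simp only [herr]
            split_ifs
            · simp
            · have : 0 ≤ β * r / 4 := by positivity
              linarith
        _ = _ := by
            rw [Finset.sum_add_distrib, Finset.sum_const, Finset.card_range, nsmul_eq_mul,
              ← Finset.sum_filter, Finset.sum_const, nsmul_eq_mul]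
            push_cast
            ring
    have hbadr : r / 6 * bad.card ≤ ε * A T / 32 + P * r := by
      have e1 : r / 6 * bad.card ≤ h / 2 * bad.card :=
        mul_le_mul_of_nonneg_right (by linarith) (Nat.cast_nonneg _)
      have e2 : 2 * P * h ≤ 2 * P * (r / 2) := by gcongr
      linarith
    have e1 : r / 4 * ((Finset.range (M + 1)).filter fun i => ¬ hit i).card ≤
        r / 4 * (1 + bad.card + ε * M / 8) := by gcongr
    have e2 : (M + 1) * r ≤ 4 * A T := by linarith
    have e3 : (M + 1) * (β * r / 4) ≤ ε / 32 * A T := by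
      calc (M + 1) * (β * r / 4) = β * ((M + 1) * r) / 4 := by ring
        _ ≤ ε / 32 * (4 * A T) / 4 := by gcongr
        _ = ε / 32 * A T := by ring
    have e4 : r / 4 * (ε * M / 8) ≤ ε * (3 * A T) / 32 := by
      calc r / 4 * (ε * M / 8) = ε * (M * r) / 32 := by ring
        _ ≤ _ := by gcongr
    have e5 : 0 < ε * A T := by positivity
    have e6 : r / 4 * (1 + bad.card + ε * M / 8) =
      r / 4 + 3 / 2 * (r / 6 * bad.card) + r / 4 * (ε * M / 8) := by ring
    have e7 : r * (3 * P + 1 / 2) = 3 * (P * r) + r / 2 := by ring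
    linarith

end Failure

end System

/-! ### Asymptotics -/

/-- The left side is n^(-η/D) n^(-1/D), and log n ≤ n. -/
theorem exp_mul_log_le_rate {D : ℕ} (hD : 0 < D) (η : ℝ) {n : ℕ} (hn : 1 ≤ Real.log n) :
    Real.exp (-((1 + η) / D * Real.log n)) ≤
      (n : ℝ) ^ (-(η / D)) * Real.log n ^ (-(1 / (D : ℝ))) := by
  have hn0 : (0 : ℝ) < n := by
    rcases Nat.eq_zero_or_pos n with rfl | h
    · simp at hn; linarith
    · exact_mod_cast h
  have hD' : (0 : ℝ) < D := by exact_mod_cast hD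
  have h1 : Real.exp (-((1 + η) / D * Real.log n)) =
      (n : ℝ) ^ (-(η / D)) * (n : ℝ) ^ (-(1 / (D : ℝ))) := by
    rw [← Real.rpow_add hn0, Real.rpow_def_of_pos hn0]
    congr 1
    field_simp
    ring
  rw [h1]
  refine mul_le_mul_of_nonneg_left ?_ (by positivity)
  refine Real.rpow_le_rpow_of_nonpos (by linarith) ?_ ?_
  · exact (Real.log_le_sub_one_of_pos hn0).trans (by linarith)
  · have : 0 ≤ 1 / (D : ℝ) := by positivity
    linarith

theorem exp_succ_mul_log_le_rate {D : ℕ} (hD : 0 < D) (η : ℝ) {n : ℕ} (hn : 1 ≤ Real.log n) :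
    Real.exp (-((η / D + 1) * Real.log n)) ≤
      (n : ℝ) ^ (-(η / D)) * Real.log n ^ (-(1 / (D : ℝ))) := by
  refine le_trans (Real.exp_le_exp.2 ?_) (exp_mul_log_le_rate hD η hn)
  have hD' : (1 : ℝ) ≤ D := by exact_mod_cast hD
  have h1 : (1 + η) / D ≤ η / D + 1 := by
    rw [add_div, add_comm]
    gcongr
    rw [div_le_one (by linarith)]
    exact hD'
  have := mul_le_mul_of_nonneg_right h1 (zero_le_one.trans hn)
  linarith

/-- The number of boxes, of order 1/ρ, times the probability of missing one: the powers n^(1/D)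
cancel and the logarithm remains. -/
theorem inv_rpow_mul_exp_eq_rate {D : ℕ} (hD : 0 < D) (η : ℝ) {K : ℝ} (hK : 0 < K) {n : ℕ}
    (hn : 1 ≤ Real.log n) :
    ((K * (Real.log n / n)) ^ (1 / (D : ℝ)))⁻¹ * Real.exp (-((1 + η) / D * Real.log n)) =
      (K ^ (1 / (D : ℝ)))⁻¹ * ((n : ℝ) ^ (-(η / D)) * Real.log n ^ (-(1 / (D : ℝ)))) := by
  have hn0 : (0 : ℝ) < n := by
    rcases Nat.eq_zero_or_pos n with rfl | h
    · simp at hn; linarith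
    · exact_mod_cast h
  have hl : 0 < Real.log n := by linarith
  have hD' : (0 : ℝ) < D := by exact_mod_cast hD
  have h1 : Real.exp (-((1 + η) / D * Real.log n)) =
      (n : ℝ) ^ (-(η / D)) * ((n : ℝ) ^ (1 / (D : ℝ)))⁻¹ := by
    rw [← Real.rpow_neg hn0.le, ← Real.rpow_add hn0, Real.rpow_def_of_pos hn0]
    congr 1
    field_simp
    ring
  rw [h1, Real.mul_rpow hK.le (by positivity), Real.div_rpow hl.le hn0.le, Real.rpow_neg hl.le]
  have e1 : (n : ℝ) ^ (1 / (D : ℝ)) ≠ 0 := (Real.rpow_pos_of_pos hn0 _).ne'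
  have e2 : Real.log n ^ (1 / (D : ℝ)) ≠ 0 := (Real.rpow_pos_of_pos hl _).ne'
  have e3 : K ^ (1 / (D : ℝ)) ≠ 0 := (Real.rpow_pos_of_pos hK _).ne'
  field_simp

/-- Since 2^(M+1) ≤ exp(2M), half of the exponent cMl absorbs the number of families and the other
half gives the decay. -/
theorem two_pow_mul_exp_le {M : ℕ} (hM : 0 < M) {c l ζ : ℝ} (hl : 0 ≤ l) (hcl : 4 ≤ c * l)
    (hζ : 2 * ζ ≤ c * M) :
    2 ^ (M + 1) * Real.exp (-(c * M * l)) ≤ Real.exp (-(ζ * l)) := by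
  have hM' : (1 : ℝ) ≤ M := by exact_mod_cast hM
  have h1 : (2 : ℝ) ^ (M + 1) ≤ Real.exp (2 * M) := by
    calc (2 : ℝ) ^ (M + 1) ≤ Real.exp 1 ^ (M + 1) := by
          gcongr
          linarith [Real.add_one_le_exp (1 : ℝ)]
      _ = Real.exp (M + 1) := by rw [← Real.exp_nat_mul]; push_cast; ring_nf
      _ ≤ Real.exp (2 * M) := Real.exp_le_exp.2 (by linarith)
  calc 2 ^ (M + 1) * Real.exp (-(c * M * l))
      ≤ Real.exp (2 * M) * Real.exp (-(c * M * l)) := by gcongr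
    _ = Real.exp (2 * M + -(c * M * l)) := (Real.exp_add _ _).symm
    _ ≤ Real.exp (-(ζ * l)) := by
        refine Real.exp_le_exp.2 ?_
        have e1 : 4 * M ≤ c * l * M := by gcongr
        have e2 : 2 * ζ * l ≤ c * M * l := by gcongr
        linarith

theorem tendsto_rpow_log_div {D : ℕ} (hD : 0 < D) (K : ℝ) :
    Tendsto (fun n : ℕ => (K * (Real.log n / n)) ^ (1 / (D : ℝ))) atTop (𝓝 0) := by
  have hD' : (0 : ℝ) < D := by exact_mod_cast hD
  have h1 : Tendsto (fun n : ℕ => Real.log n / (n : ℝ)) atTop (𝓝 0) :=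
    (Real.isLittleO_log_id_atTop.tendsto_div_nhds_zero).comp tendsto_natCast_atTop_atTop
  have h2 := (h1.const_mul K).rpow_const (p := 1 / (D : ℝ)) (.inr (by positivity))
  rwa [mul_zero, Real.zero_rpow (by positivity)] at h2

namespace System

variable {N m : ℕ} {S : System N m}

theorem radius_eq {AMax η vol : ℝ} (hη : 0 ≤ η) (hvol : 0 ≤ vol) (D n : ℕ) :
    radius AMax η vol D n =
      4 * AMax * ((1 + η) * (vol / D) * (Real.log n / n)) ^ (1 / (D : ℝ)) := by
  have h1 : 0 ≤ Real.log n / n := div_nonneg (Real.log_natCast_nonneg n) (Nat.cast_nonneg n)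
  rw [radius, Real.mul_rpow (by positivity) h1, Real.mul_rpow (by positivity) (by positivity)]
  ring

theorem cond_free_apply {Mobs Q : Set (E N)} (hvol : volume (S.free Mobs) ≠ ⊤)
    (hpos : volume (S.free Mobs) ≠ 0) (hQ : Q ⊆ S.free Mobs) {c : ℝ}
    (hc : volume Q = ENNReal.ofReal c) :
    ProbabilityTheory.cond volume (S.free Mobs) Q =
      ENNReal.ofReal (c / (volume (S.free Mobs)).toReal) := by
  rw [ProbabilityTheory.cond_apply (measurableSet_free Mobs), inter_eq_right.2 hQ, hc,
    ENNReal.ofReal_div_of_pos (ENNReal.toReal_pos hpos hvol), ENNReal.ofReal_toReal hvol,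
    ENNReal.div_eq_inv_mul]

end System

end DCA

end

/-! ### Choice of the constants and the rate. -/

open DCA System in
theorem mainTheorem1 {N m : ℕ} (S : DCA.System N m) (aMin AMax σMin θMin : ℝ)
    (hS : S.Assumptions aMin AMax σMin θMin)
    (Mobs : Set (DCA.E N)) (hobs : Mobs ⊆ S.M) (hopen : IsOpen (S.M \ Mobs))
    (hvol : volume (S.free Mobs) ≠ ⊤)
    (xinit : DCA.E N) (hxinit : xinit ∈ S.free Mobs)
    (x : ℝ → DCA.E N) (T : ℝ) (hx : S.IsTrajectory x T)
    (δ : ℝ) (hδ : 0 < δ) (hclear : S.StrongClearance Mobs δ x T)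
    (ε η : ℝ) (hε : 0 < ε) (hη : 0 ≤ η)
    (D : ℕ) (hD : D = S.homDim (x 0))
    (r : ℕ → ℝ) (hr : ∀ n, r n = DCA.System.radius AMax η (volume (S.free Mobs)).toReal D n) :
    (fun n : ℕ => (S.sampleFree Mobs n (S.traceEvent xinit x T ε (r n) n)ᶜ).toReal)
      =O[atTop] fun n : ℕ => (n : ℝ) ^ (-(η / D)) * (Real.log n) ^ (-(1 / (D : ℝ))) := by
  have hprob := isProbabilityMeasure_cond_free hopen ⟨xinit, hxinit⟩ hvol
  have hvol0 := (volume_free_pos hopen ⟨xinit, hxinit⟩).ne'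
  have h0T : (0 : ℝ) ∈ Icc 0 T := ⟨le_rfl, hx.1⟩
  -- In dimension 0 also D = 0; division by zero yields exponents 0, the claimed rate is the
  -- constant 1, and the trivial bound suffices.
  rcases Nat.eq_zero_or_pos N with rfl | hN
  · have hD0 : D = 0 := by rw [hD, homDim]; simp
    refine Asymptotics.IsBigO.of_bound 1 (Eventually.of_forall fun n => ?_)
    have : IsProbabilityMeasure (S.sampleFree Mobs n) := by
      unfold sampleFree; infer_instance
    rw [Real.norm_of_nonneg ENNReal.toReal_nonneg, hD0]
    simpa using ENNReal.toReal_mono ENNReal.one_ne_top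
      (prob_le_one (μ := S.sampleFree Mobs n) (s := (S.traceEvent xinit x T ε (r n) n)ᶜ))
  have hDpos : 0 < D := hD ▸ homDim_pos hS.bracketGenerating hN (hx.2.2.1 0 h0T)
  have hD' : (0 : ℝ) < D := by exact_mod_cast hDpos
  have hAM := hS.AMax_pos
  set μ := (volume (S.free Mobs)).toReal with hμ
  have hμ0 : 0 < μ := ENNReal.toReal_pos hvol0 hvol
  set K := (1 + η) * (μ / D) with hK
  have hK0 : 0 < K := by positivity
  set ρ : ℕ → ℝ := fun n => (K * (Real.log n / n)) ^ (1 / (D : ℝ)) with hρ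
  have hrρ : ∀ n, r n = 4 * AMax * ρ n := fun n => (hr n).trans (radius_eq hη hμ0.le D n)
  have hρlim : Tendsto ρ atTop (𝓝 0) := tendsto_rpow_log_div hDpos K
  have hrlim : Tendsto r atTop (𝓝 0) := by
    have := hρlim.const_mul (4 * AMax)
    rw [mul_zero] at this
    exact this.congr fun n => (hrρ n).symm
  have hlog : Tendsto (fun n : ℕ => Real.log n) atTop atTop :=
    Real.tendsto_log_atTop.comp tendsto_natCast_atTop_atTop
  have hρpos : ∀ n : ℕ, 1 ≤ Real.log n → 0 < ρ n := by
    intro n hn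
    have hn0 : (0 : ℝ) < n := by
      rcases Nat.eq_zero_or_pos n with rfl | h
      · simp at hn; linarith
      · exact_mod_cast h
    exact Real.rpow_pos_of_pos (by positivity) _
  -- This identity is the reason for the constants in the radius: μ cancels and exactly (1 + η)/D ·
  -- log n is left.
  have hρD : ∀ n : ℕ, 1 ≤ Real.log n → ∀ C : ℝ, n * (C * ρ n ^ D / μ) =
      C * ((1 + η) / D * Real.log n) := by
    intro n hn C
    have hn0 : (0 : ℝ) < n := by
      rcases Nat.eq_zero_or_pos n with rfl | h
      · simp at hn; linarith
      · exact_mod_cast h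
    have : ρ n ^ D = K * (Real.log n / n) := by
      simp only [hρ, one_div]
      exact Real.rpow_inv_natCast_pow (by positivity) hDpos.ne'
    rw [this, hK]
    field_simp
  obtain ⟨ρ₀, hρ₀, hboxes⟩ := hS.exists_boxes hN hx hδ hclear
  rw [← hD] at hboxes
  obtain ⟨A, hA⟩ := hx.exists_isLengthFunction
  have hAT : 0 ≤ A T := by rw [← hA.zero]; exact hA.mono h0T ⟨hx.1, le_rfl⟩ hx.1
  have h2N : (1 : ℝ) ≤ 2 ^ N := one_le_pow₀ one_le_two
  have hexp : ∀ n : ℕ, 1 ≤ Real.log n → Real.exp (-(n * (2 ^ N * ρ n ^ D / μ))) ≤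
      Real.exp (-((1 + η) / D * Real.log n)) := by
    intro n hn
    rw [hρD n hn]
    refine Real.exp_le_exp.2 (neg_le_neg ?_)
    exact le_mul_of_one_le_left (by positivity) h2N
  have hgnn : ∀ n : ℕ, 1 ≤ Real.log n →
      0 ≤ (n : ℝ) ^ (-(η / D)) * Real.log n ^ (-(1 / (D : ℝ))) := fun n hn =>
    mul_nonneg (Real.rpow_nonneg (Nat.cast_nonneg n) _) (Real.rpow_nonneg (by linarith) _)
  -- A trajectory of zero length is stationary, so a single waypoint suffices.
  rcases hAT.eq_or_lt with hzero | hAT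
  · refine Asymptotics.IsBigO.of_bound 1 ?_
    filter_upwards [hlog.eventually_ge_atTop 1, hρlim.eventually_le_const hρ₀] with n hn hnρ
    have hρn := hρpos n hn
    obtain ⟨Q, hQ⟩ := hboxes 0 h0T
    obtain ⟨hm, hsub, hv, hd⟩ := hQ (ρ n) hρn.le hnρ
    have hb := (cond_free_apply hvol hvol0 hsub hv).ge
    have hrn : r n / 4 = AMax * ρ n := by rw [hrρ]; ring
    have hle := hA.measure_compl_traceEvent_le_of_eq_zero (xinit := xinit) hx hzero.symm ε
      (r := r n) (by rw [hrρ]; positivity) n hm hb (by rw [hrn]; exact hd)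
    rw [Real.norm_of_nonneg ENNReal.toReal_nonneg, Real.norm_of_nonneg (hgnn n hn), one_mul]
    exact (ENNReal.toReal_le_of_le_ofReal (Real.exp_pos _).le hle).trans
      ((hexp n hn).trans (exp_mul_log_le_rate hDpos η hn))
  · obtain ⟨P, hP, hfam⟩ := hA.exists_separated_families hx hAT
      (show 0 < ε * A T / 32 by positivity)
    have hP' : (0 : ℝ) < P := by exact_mod_cast hP
    set β := min (1 / 8) (ε / 32) with hβ
    have hβ0 : 0 < β := lt_min (by norm_num) (by positivity)
    -- Missing `ε * M / (8 * P)` disjoint small boxes has probability at most exp(-c₀ M log n).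
    set c₀ := ε / (8 * P) * (2 ^ N * β ^ D * ((1 + η) / D)) with hc₀
    have hc₀0 : 0 < c₀ := by positivity
    have hζ : 0 < η / D + 1 := by positivity
    -- The first summand comes from the large boxes, through M + 1 ≤ 4 c(x)/r = (c(x)/`AMax`)/ρ; the
    -- 1 comes from the families of small boxes.
    refine Asymptotics.IsBigO.of_bound (A T / AMax * (K ^ (1 / (D : ℝ)))⁻¹ + 1) ?_
    filter_upwards [hlog.eventually_ge_atTop 1, hlog.eventually_ge_atTop (4 / c₀),
      hρlim.eventually_le_const hρ₀, hrlim.eventually_le_const hAT,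
      hrlim.eventually_le_const (show 0 < ε * A T / 8 / (3 * P + 1 / 2) by positivity),
      hrlim.eventually_le_const (show 0 < c₀ * A T / (η / D + 1) by positivity)]
      with n hn hn4 hnρ hnL hnP hnc
    have hρn := hρpos n hn
    have hrpos : 0 < r n := by rw [hrρ]; positivity
    rw [le_div_iff₀ (by positivity)] at hnP
    have hβρ : β * ρ n ≤ ρ₀ := by
      refine le_trans ?_ hnρ
      exact mul_le_of_le_one_left hρn.le ((min_le_left _ _).trans (by norm_num))
    have hle := hA.measure_compl_traceEvent_le (xinit := xinit) (Mobs := Mobs) hx hAT hε hP hfam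
      hβ0 (min_le_left _ _) (min_le_right _ _) hrpos hnL hnP
      (b := 2 ^ N * ρ n ^ D / μ) (c := 2 ^ N * (β * ρ n) ^ D / μ) (by positivity) (by
        intro t ht
        obtain ⟨Q, hQ⟩ := hboxes t ht
        obtain ⟨hm, hsub, hv, hd⟩ := hQ (ρ n) hρn.le hnρ
        obtain ⟨hm', hsub', hv', hd'⟩ := hQ (β * ρ n) (by positivity) hβρ
        have hrn : r n / 4 = AMax * ρ n := by rw [hrρ]; ring
        have hrn' : β * r n / 4 = AMax * (β * ρ n) := by rw [hrρ]; ring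
        refine ⟨Q (ρ n), Q (β * ρ n), hm, hm', (cond_free_apply hvol hvol0 hsub hv).ge,
          (cond_free_apply hvol hvol0 hsub' hv').ge, ?_, ?_⟩
        · rw [hrn]; exact hd
        · rw [hrn']; exact hd') n
    set M := ⌈2 * A T / r n⌉₊ with hM
    have hMpos : 0 < M := Nat.ceil_pos.2 (by positivity)
    have hMge : 2 * A T / r n ≤ M := Nat.le_ceil _
    have hMle : (M : ℝ) + 1 ≤ A T / AMax * (ρ n)⁻¹ := by
      have h1 : (M : ℝ) ≤ 2 * (A T / r n) + 1 := by
        rw [← mul_div_assoc]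
        exact (Nat.ceil_lt_add_one (by positivity)).le
      have h2 : 1 ≤ A T / r n := (one_le_div hrpos).2 hnL
      have h3 : A T / AMax * (ρ n)⁻¹ = 4 * (A T / r n) := by rw [hrρ]; field_simp
      rw [h3]
      linarith
    have hexponent : n * (ε * M / (8 * P) * (2 ^ N * (β * ρ n) ^ D / μ)) =
        c₀ * M * Real.log n := by
      have h1 : n * (ε * M / (8 * P) * (2 ^ N * (β * ρ n) ^ D / μ)) =
          ε * M / (8 * P) * (n * (2 ^ N * β ^ D * ρ n ^ D / μ)) := by
        rw [mul_pow]; ring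
      rw [h1, hρD n hn, hc₀]
      ring
    rw [hexponent] at hle
    rw [Real.norm_of_nonneg ENNReal.toReal_nonneg, Real.norm_of_nonneg (hgnn n hn)]
    refine (ENNReal.toReal_le_of_le_ofReal (by positivity) hle).trans ?_
    rw [add_mul (A T / AMax * _), one_mul]
    refine add_le_add ?_ ?_
    · rw [mul_assoc (A T / AMax), ← inv_rpow_mul_exp_eq_rate hDpos η hK0 hn, ← mul_assoc]
      exact mul_le_mul hMle (hexp n hn) (Real.exp_pos _).le (by positivity)
    · refine (two_pow_mul_exp_le hMpos (ζ := η / D + 1) (by linarith) ?_ ?_).trans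
        (exp_succ_mul_log_le_rate hDpos η hn)
      · rwa [div_le_iff₀' hc₀0] at hn4
      · rw [le_div_iff₀ hζ] at hnc
        have h1 : η / D + 1 ≤ c₀ * A T / r n := by
          rw [le_div_iff₀ hrpos]; linarith
        calc 2 * (η / D + 1) ≤ 2 * (c₀ * A T / r n) := by gcongr
          _ = c₀ * (2 * A T / r n) := by ring
          _ ≤ c₀ * M := by gcongr
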